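/- Let $M$ be a nonempty closed smooth manifold (compact, Hausdorff, without boundary) of dimension $n$. For a smooth Riemannian metric $g$ on $M$ with Riemann curvature tensor $R$ (with the sign convention for which $R(e_i,e_j,e_i,e_j)$ is the sectional curvature for orthonormal $e_i,e_j$) and scalar curvature $\mathrm{Scal}$, and for $t\in\mathbb R$, put $$\mathrm{Riem}_t(g):=\mathrm{Scal}\,\frac{g^2}{2}-2t\,R ,$$ where $g^2$ is the Kulkarni--Nomizu square of $g$. Write $\mathrm{Riem}_t(g)>0$ if at every point of $M$ this tensor is positive definite as a quadratic form on bivectors (elements of $\Lambda^2T_pM$). If $g$ has positive scalar curvature at every point, define $$\mathrm{Riem}(g):=\sup\{t\in(0,\tfrac{n(n-1)}2):\ \mathrm{Riem}_t(g)>0\}$$ (with $\sup\emptyset=0$), and otherwise set $\mathrm{Riem}(g):=0$. Let $$\mathbf{Riem}(M):=\sup\{\mathrm{Riem}(g):\ g \text{ a smooth Riemannian metric on } M\}.$$ **Proposition (ideal property).** Let $M_1$ and $M_2$ be nonempty closed smooth manifolds. Then $$\mathbf{Riem}(M_1\times M_2)\ \ge\ \max\{\mathbf{Riem}(M_1),\mathbf{Riem}(M_2)\}.$$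 -/

import Mathlib

open scoped Manifold ContDiff

noncomputable section

namespace RiemInv

/-! ### Local Riemannian geometry

`G y` is the matrix of a Riemannian metric at the point `y` of a (finite-dimensional) vector
space `E`, i.e. the metric written in a coordinate chart with values in `E`. -/

section Local

variable {E : Type*} [NormedAddCommGroup E] [NormedSpace ℝ E]

set_option maxSynthPendingDepth 5 in
/-- Christoffel symbols of the first kind:
`(u, v, w) ↦ (∂_u G(v, w) + ∂_v G(u, w) - ∂_w G(u, v)) / 2`. -/
def christoffelLower (G : E → E →L[ℝ] E →L[ℝ] ℝ) (y : E) : E →L[ℝ] E →L[ℝ] E →L[ℝ] ℝ :=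
  (1 / 2 : ℝ) • (fderiv ℝ G y + (fderiv ℝ G y).flip -
    ((ContinuousLinearMap.flipₗᵢ ℝ E E ℝ).toContinuousLinearEquiv :
      (E →L[ℝ] E →L[ℝ] ℝ) →L[ℝ] (E →L[ℝ] E →L[ℝ] ℝ)).comp (fderiv ℝ G y).flip)

set_option maxSynthPendingDepth 5 in
theorem christoffelLower_apply (G : E → E →L[ℝ] E →L[ℝ] ℝ) (y u v w : E) :
    christoffelLower G y u v w =
      (1 / 2 : ℝ) * (fderiv ℝ G y u v w + fderiv ℝ G y v u w - fderiv ℝ G y w u v) := by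
  simp [christoffelLower]

/-- Christoffel symbols of the second kind: `christoffel G y u v` is the vector `Γ(u, v)` with
`G(Γ(u, v), w) = christoffelLower G y u v w` for all `w`. -/
def christoffel (G : E → E →L[ℝ] E →L[ℝ] ℝ) (y : E) : E →L[ℝ] E →L[ℝ] E :=
  (ContinuousLinearMap.compL ℝ E (E →L[ℝ] ℝ) E (G y).inverse).comp (christoffelLower G y)

theorem christoffel_apply (G : E → E →L[ℝ] E →L[ℝ] ℝ) (y u v : E) :
    christoffel G y u v = (G y).inverse (christoffelLower G y u v) := by
  simp [christoffel]

/-- The Riemann curvature endomorphism `R(u, v) = [∇_u, ∇_v] - ∇_[u, v]` of the Levi-Civita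
connection of `G`, written in coordinates. -/
def curvature (G : E → E →L[ℝ] E →L[ℝ] ℝ) (y u v : E) : E →L[ℝ] E :=
  fderiv ℝ (christoffel G) y u v - fderiv ℝ (christoffel G) y v u
    + (christoffel G y u).comp (christoffel G y v)
    - (christoffel G y v).comp (christoffel G y u)

/-- The Riemann curvature tensor as a `(0, 4)`-tensor, with the sign for which
`curvature4 G y u v u v` is the sectional curvature when `u, v` are orthonormal. -/
def curvature4 (G : E → E →L[ℝ] E →L[ℝ] ℝ) (y u v w z : E) : ℝ :=
  G y (curvature G y u v z) w

/-- The endomorphism `u ↦ R(u, v) w`. -/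
def ricciEnd (G : E → E →L[ℝ] E →L[ℝ] ℝ) (y v w : E) : E →ₗ[ℝ] E where
  toFun u := curvature G y u v w
  map_add' a b := by simp [curvature]; abel
  map_smul' c a := by simp [curvature, smul_sub, smul_add]

/-- The Ricci tensor `Ric(v, w) = tr (u ↦ R(u, v) w)`. -/
def ricci (G : E → E →L[ℝ] E →L[ℝ] ℝ) (y : E) : E →ₗ[ℝ] E →ₗ[ℝ] ℝ :=
  LinearMap.mk₂ ℝ (fun v w => LinearMap.trace ℝ E (ricciEnd G y v w))
    (fun a b w => by
      rw [← map_add]; congr 1; ext u; simp [ricciEnd, curvature]; abel)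
    (fun c a w => by
      rw [← map_smul]; congr 1; ext u; simp [ricciEnd, curvature, smul_sub, smul_add])
    (fun v a b => by
      rw [← map_add]; congr 1; ext u; simp [ricciEnd])
    (fun c v a => by
      rw [← map_smul]; congr 1; ext u; simp [ricciEnd])

variable [FiniteDimensional ℝ E]

/-- The scalar curvature: the trace of the Ricci tensor with respect to `G`, i.e. the trace of the
endomorphism `v ↦ Ric(v, ·)^♯`. -/
def scal (G : E → E →L[ℝ] E →L[ℝ] ℝ) (y : E) : ℝ :=
  LinearMap.trace ℝ E
    ((G y).inverse.toLinearMap ∘ₗ (LinearMap.toContinuousLinearMap.toLinearMap ∘ₗ ricci G y))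

/-- The Kulkarni-Nomizu product of two symmetric bilinear forms. -/
def kulkarniNomizu (h k : E →L[ℝ] E →L[ℝ] ℝ) (u v w z : E) : ℝ :=
  h u w * k v z + h v z * k u w - h u z * k v w - h v w * k u z

/-- The curvature tensor `Riem_t = Scal * g² / 2 - 2 t R`, where `g²` is the Kulkarni-Nomizu square
of the metric. -/
def riemTensor (G : E → E →L[ℝ] E →L[ℝ] ℝ) (y : E) (t : ℝ) (u v w z : E) : ℝ :=
  scal G y * (kulkarniNomizu (G y) (G y) u v w z / 2) - 2 * t * curvature4 G y u v w z

/-- Positive definiteness of a curvature-like tensor `T`, seen as a quadratic form on bivectors: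
`T(ω, ω) > 0` for every nonzero `ω = ∑ a, x a ∧ y a` in the exterior square of `E`. -/
def PosDefOnBivectors (T : E → E → E → E → ℝ) : Prop :=
  ∀ (k : ℕ) (x y : Fin k → E),
    ∑ a, exteriorPower.ιMulti ℝ 2 ![x a, y a] ≠ 0 →
      0 < ∑ a, ∑ b, T (x a) (y a) (x b) (y b)

end Local

/-! ### Riemannian metrics on manifolds without boundary -/

section Manifold

variable {E : Type*} [NormedAddCommGroup E] [NormedSpace ℝ E]
  {H : Type*} [TopologicalSpace H] (I : ModelWithCorners ℝ E H)
  (M : Type*) [TopologicalSpace M] [ChartedSpace H M] [IsManifold I ∞ M]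

/-- The smooth Riemannian metrics on `M`. -/
abbrev Metric : Type _ :=
  Bundle.ContMDiffRiemannianMetric I ∞ E (fun x : M => TangentSpace I x)

variable {I M}

/-- The metric `g` in the preferred chart at `p`: the pullback of `g` by the inverse chart. -/
def metricInChart (g : Metric I M) (p : M) (y : E) : E →L[ℝ] E →L[ℝ] ℝ :=
  let A : E →L[ℝ] E := mfderiv 𝓘(ℝ, E) I (extChartAt I p).symm y
  let B : E →L[ℝ] E →L[ℝ] ℝ := g.inner ((extChartAt I p).symm y)
  B.bilinearComp A A

theorem metricInChart_apply (g : Metric I M) (p : M) (y u v : E) :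
    metricInChart g p y u v = g.inner ((extChartAt I p).symm y)
      (mfderiv 𝓘(ℝ, E) I (extChartAt I p).symm y u)
      (mfderiv 𝓘(ℝ, E) I (extChartAt I p).symm y v) := rfl

variable [FiniteDimensional ℝ E]

/-- The scalar curvature of `g` at `p`. -/
def scalAt (g : Metric I M) (p : M) : ℝ :=
  scal (metricInChart g p) (extChartAt I p p)

/-- The tensor `Riem_t(g)` at `p`, in the chart at `p`. -/
def riemTensorAt (g : Metric I M) (t : ℝ) (p : M) : E → E → E → E → ℝ :=
  riemTensor (metricInChart g p) (extChartAt I p p) t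

/-- `Riem_t(g) > 0`: positive definite at each point of `M`. -/
def RiemTensorPos (g : Metric I M) (t : ℝ) : Prop :=
  ∀ p : M, PosDefOnBivectors (riemTensorAt g t p)

open Classical in
/-- The metric invariant `Riem(g) = sup {t ∈ (0, n(n-1)/2) : Riem_t(g) > 0}`, set to be `0` if the
scalar curvature of `g` is not positive; `n` is the dimension of `M`. -/
def riemMetric (g : Metric I M) : ℝ :=
  if ∀ p : M, 0 < scalAt g p then
    sSup {t : ℝ | 0 < t ∧
      t < (Module.finrank ℝ E : ℝ) * ((Module.finrank ℝ E : ℝ) - 1) / 2 ∧ RiemTensorPos g t}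
  else 0

theorem riemMetric_nonneg (g : Metric I M) : 0 ≤ riemMetric g := by
  unfold riemMetric
  split_ifs
  · exact Real.sSup_nonneg fun t ht => ht.1.le
  · exact le_rfl

theorem riemMetric_le (g : Metric I M) :
    riemMetric g ≤ (Module.finrank ℝ E : ℝ) * ((Module.finrank ℝ E : ℝ) - 1) / 2 := by
  have h0 : 0 ≤ (Module.finrank ℝ E : ℝ) * ((Module.finrank ℝ E : ℝ) - 1) / 2 := by
    rcases Nat.eq_zero_or_pos (Module.finrank ℝ E) with h | h
    · simp [h]
    · have : (1 : ℝ) ≤ Module.finrank ℝ E := by exact_mod_cast h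
      have := mul_nonneg (by linarith : (0 : ℝ) ≤ Module.finrank ℝ E) (sub_nonneg.2 this)
      linarith
  unfold riemMetric
  split_ifs
  · exact Real.sSup_le (fun t ht => ht.2.1.le) h0
  · exact h0

variable (I M)

/-- The smooth invariant `Riem(M)`: the supremum of `Riem(g)` over all Riemannian metrics `g`
on `M`. -/
def riemManifold : ℝ := sSup (Set.range fun g : Metric I M => riemMetric g)

/-- The supremum that defines `Riem(M)` is over a bounded set. -/
theorem bddAbove_riemMetric : BddAbove (Set.range fun g : Metric I M => riemMetric g) :=
  ⟨_, by rintro _ ⟨g, rfl⟩; exact riemMetric_le g⟩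

end Manifold

end RiemInv

end

noncomputable section

set_option synthInstance.maxHeartbeats 200000

namespace RiemInv

open Filter Topology

section LocalGeometry

variable {E : Type*} [NormedAddCommGroup E] [NormedSpace ℝ E]

/-- `G` is a smooth Riemannian metric in a neighbourhood of `y`. -/
structure MetricNear (G : E → E →L[ℝ] E →L[ℝ] ℝ) (y : E) : Prop where
  contDiffAt : ∀ᶠ z in 𝓝 y, ContDiffAt ℝ ∞ G z
  symm : ∀ᶠ z in 𝓝 y, ∀ u v, G z u v = G z v u
  pos : ∀ᶠ z in 𝓝 y, ∀ v, v ≠ 0 → 0 < G z v v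

theorem MetricNear.eventually {G : E → E →L[ℝ] E →L[ℝ] ℝ} {y : E} (h : MetricNear G y) :
    ∀ᶠ z in 𝓝 y, MetricNear G z := by
  filter_upwards [h.contDiffAt.eventually_nhds, h.symm.eventually_nhds, h.pos.eventually_nhds]
    with z h1 h2 h3 using ⟨h1, h2, h3⟩

theorem christoffelLower_congr {G G' : E → E →L[ℝ] E →L[ℝ] ℝ} {y : E} (hG : G' =ᶠ[𝓝 y] G) :
    christoffelLower G' y = christoffelLower G y := by
  simp only [christoffelLower, hG.fderiv_eq]

theorem christoffel_congr {G G' : E → E →L[ℝ] E →L[ℝ] ℝ} {y : E} (hG : G' =ᶠ[𝓝 y] G) :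
    christoffel G' =ᶠ[𝓝 y] christoffel G := by
  filter_upwards [hG.eventuallyEq_nhds] with z hz
  simp only [christoffel, christoffelLower_congr hz, hz.self_of_nhds]

theorem curvature_congr {G G' : E → E →L[ℝ] E →L[ℝ] ℝ} {y : E} (hG : G' =ᶠ[𝓝 y] G) :
    curvature G' y = curvature G y := by
  ext u v
  simp only [curvature, (christoffel_congr hG).fderiv_eq, (christoffel_congr hG).self_of_nhds]

theorem curvature4_congr {G G' : E → E →L[ℝ] E →L[ℝ] ℝ} {y : E} (hG : G' =ᶠ[𝓝 y] G) :
    curvature4 G' y = curvature4 G y := by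
  ext u v w z
  simp only [curvature4, curvature_congr hG, hG.self_of_nhds]

theorem ricci_congr {G G' : E → E →L[ℝ] E →L[ℝ] ℝ} {y : E} (hG : G' =ᶠ[𝓝 y] G) :
    ricci G' y = ricci G y := by
  ext u v
  simp only [ricci, ricciEnd, curvature_congr hG]

theorem scal_congr [FiniteDimensional ℝ E] {G G' : E → E →L[ℝ] E →L[ℝ] ℝ} {y : E}
    (hG : G' =ᶠ[𝓝 y] G) : scal G' y = scal G y := by
  simp only [scal, ricci_congr hG, hG.self_of_nhds]

theorem fderiv_apply₂ {G : E → E →L[ℝ] E →L[ℝ] ℝ} {y : E} (hG : DifferentiableAt ℝ G y)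
    (u v w : E) : fderiv ℝ G y u v w = fderiv ℝ (fun z => G z v w) y u := by
  have h1 : HasFDerivAt (fun z => G z v w) _ y :=
    (hG.hasFDerivAt.clm_apply (hasFDerivAt_const v y)).clm_apply (hasFDerivAt_const w y)
  rw [h1.fderiv]
  simp

theorem MetricNear.differentiableAt {G : E → E →L[ℝ] E →L[ℝ] ℝ} {y : E} (h : MetricNear G y) :
    DifferentiableAt ℝ G y :=
  h.contDiffAt.self_of_nhds.differentiableAt (by simp)

theorem MetricNear.fderiv_symm {G : E → E →L[ℝ] E →L[ℝ] ℝ} {y : E} (h : MetricNear G y)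
    (u v w : E) :
    fderiv ℝ G y u v w = fderiv ℝ G y u w v := by
  have hd := h.contDiffAt.self_of_nhds.differentiableAt (by simp)
  rw [fderiv_apply₂ hd, fderiv_apply₂ hd]
  have : (fun z => G z v w) =ᶠ[𝓝 y] fun z => G z w v := by
    filter_upwards [h.symm] with z hz using hz v w
  rw [this.fderiv_eq]

theorem MetricNear.continuousAt {G : E → E →L[ℝ] E →L[ℝ] ℝ} {y : E} (h : MetricNear G y) :
    ContinuousAt G y :=
  h.contDiffAt.self_of_nhds.continuousAt

theorem curvature_apply (G : E → E →L[ℝ] E →L[ℝ] ℝ) (y u v z : E) :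
    curvature G y u v z = fderiv ℝ (christoffel G) y u v z - fderiv ℝ (christoffel G) y v u z
      + christoffel G y u (christoffel G y v z) - christoffel G y v (christoffel G y u z) := by
  simp [curvature]

theorem curvature_antisymm (G : E → E →L[ℝ] E →L[ℝ] ℝ) (y u v : E) :
    curvature G y u v = - curvature G y v u := by
  simp only [curvature]; abel

variable [FiniteDimensional ℝ E]

theorem isInvertible_of_pos {B : E →L[ℝ] E →L[ℝ] ℝ} (hB : ∀ v, v ≠ 0 → 0 < B v v) :
    B.IsInvertible := by
  have hinj : Function.Injective B.toLinearMap := by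
    rw [← LinearMap.ker_eq_bot, LinearMap.ker_eq_bot']
    intro v hv
    by_contra hne
    have := hB v hne
    rw [show B v = 0 from hv] at this
    simp at this
  have hdim : Module.finrank ℝ E = Module.finrank ℝ (E →L[ℝ] ℝ) := by
    rw [← (LinearMap.toContinuousLinearMap (𝕜 := ℝ) (E := E) (F' := ℝ)).finrank_eq]
    exact Subspace.dual_finrank_eq.symm
  exact ⟨(LinearEquiv.ofInjectiveOfFinrankEq B.toLinearMap hinj hdim).toContinuousLinearEquiv,
    by ext v; rfl⟩

section MetricNear

variable {G : E → E →L[ℝ] E →L[ℝ] ℝ} {y : E}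

theorem MetricNear.isInvertible (h : MetricNear G y) : (G y).IsInvertible :=
  isInvertible_of_pos h.pos.self_of_nhds

theorem MetricNear.ext (h : MetricNear G y) {u v : E} (huv : ∀ w, G y u w = G y v w) : u = v := by
  obtain ⟨e, he⟩ := h.isInvertible
  apply e.injective
  have : G y u = G y v := by ext w; exact huv w
  rw [← he] at this
  exact this

theorem MetricNear.apply_inverse (h : MetricNear G y) (f : E →L[ℝ] ℝ) :
    G y ((G y).inverse f) = f := by
  obtain ⟨e, he⟩ := h.isInvertible
  rw [← he]; simp

theorem MetricNear.christoffel_spec (h : MetricNear G y) (u v w : E) :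
    G y (christoffel G y u v) w = christoffelLower G y u v w := by
  rw [christoffel_apply, h.apply_inverse]

/-- The Levi-Civita connection is metric. -/
theorem MetricNear.fderiv_eq (h : MetricNear G y) (u v w : E) :
    fderiv ℝ G y u v w = G y (christoffel G y u v) w + G y v (christoffel G y u w) := by
  rw [h.symm.self_of_nhds v, h.christoffel_spec, h.christoffel_spec, christoffelLower_apply,
    christoffelLower_apply, h.fderiv_symm u w v]
  ring

set_option maxSynthPendingDepth 5 in
theorem contDiffAt_christoffel (hG : ContDiffAt ℝ ∞ G y) (hy : (G y).IsInvertible) :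
    ContDiffAt ℝ ∞ (christoffel G) y := by
  have h1 : ContDiffAt ℝ ∞ (fderiv ℝ G) y := hG.fderiv_right (by simp)
  have h2 : ContDiffAt ℝ ∞ (fun z => (fderiv ℝ G z).flip) y :=
    (ContinuousLinearMap.flipₗᵢ ℝ E E (E →L[ℝ] ℝ)).contDiff.contDiffAt.comp y h1
  have h3 : ContDiffAt ℝ ∞ (christoffelLower G) y :=
    ((h1.add h2).sub (contDiffAt_const.clm_comp h2)).const_smul (1 / 2 : ℝ)
  have h4 : ContDiffAt ℝ ∞ (fun z => (G z).inverse) y := by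
    obtain ⟨e, he⟩ := hy
    have := contDiffAt_map_inverse (𝕜 := ℝ) (n := ∞) e
    rw [he] at this
    exact this.comp y hG
  exact (((ContinuousLinearMap.compL ℝ E (E →L[ℝ] ℝ) E).contDiff.contDiffAt.comp y h4)).clm_comp h3

theorem MetricNear.contDiffAt_christoffel (h : MetricNear G y) :
    ContDiffAt ℝ ∞ (christoffel G) y :=
  RiemInv.contDiffAt_christoffel h.contDiffAt.self_of_nhds h.isInvertible

theorem MetricNear.differentiableAt_christoffel (h : MetricNear G y) :
    DifferentiableAt ℝ (christoffel G) y :=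
  h.contDiffAt_christoffel.differentiableAt (by simp)

/-- The second derivative of `G(z, z)` in terms of the Levi-Civita connection. -/
theorem MetricNear.fderiv_fderiv_apply (h : MetricNear G y) (u v z : E) :
    fderiv ℝ (fderiv ℝ (fun x => G x z z)) y v u =
      2 * (G y (christoffel G y v (christoffel G y u z)) z
        + G y (christoffel G y u z) (christoffel G y v z)
        + G y (fderiv ℝ (christoffel G) y v u z) z) := by
  have h0 : ContDiffAt ℝ ∞ (fun x => G x z z) y :=
    ((h.contDiffAt.self_of_nhds).clm_apply contDiffAt_const).clm_apply contDiffAt_const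
  have h1 : DifferentiableAt ℝ (fderiv ℝ (fun x => G x z z)) y :=
    (h0.fderiv_right (m := ∞) (by simp)).differentiableAt (by simp)
  have h2 : fderiv ℝ (fderiv ℝ (fun x => G x z z)) y v u =
      fderiv ℝ (fun x => fderiv ℝ (fun x => G x z z) x u) y v := by
    have := (h1.hasFDerivAt.clm_apply (hasFDerivAt_const u y)).fderiv
    rw [this]; simp
  have h3 : (fun x => fderiv ℝ (fun x => G x z z) x u) =ᶠ[𝓝 y]
      fun x => 2 * G x (christoffel G x u z) z := by
    filter_upwards [h.eventually] with x hx
    rw [← fderiv_apply₂ hx.differentiableAt, hx.fderiv_eq, hx.symm.self_of_nhds z]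
    ring
  have hΓ := ((h.differentiableAt_christoffel.hasFDerivAt.clm_apply
    (hasFDerivAt_const u y)).clm_apply (hasFDerivAt_const z y))
  have h4 := ((h.differentiableAt.hasFDerivAt.clm_apply hΓ).clm_apply
    (hasFDerivAt_const z y)).const_mul 2
  rw [h2, h3.fderiv_eq, h4.fderiv]
  simp only [smul_apply, add_apply,
    ContinuousLinearMap.flip_apply, ContinuousLinearMap.comp_apply, zero_apply,
    map_zero, smul_eq_mul, zero_add, h.fderiv_eq]
  ring

theorem MetricNear.curvature4_self (h : MetricNear G y) (u v z : E) :
    curvature4 G y u v z z = 0 := by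
  have h0 : ContDiffAt ℝ ∞ (fun x => G x z z) y :=
    ((h.contDiffAt.self_of_nhds).clm_apply contDiffAt_const).clm_apply contDiffAt_const
  have hs := (h0.isSymmSndFDerivAt (by simpa using ENat.LEInfty.out)).eq u v
  rw [h.fderiv_fderiv_apply, h.fderiv_fderiv_apply,
    h.symm.self_of_nhds (christoffel G y u z)] at hs
  simp only [curvature4, curvature_apply, map_add, map_sub, add_apply,
    sub_apply]
  linarith

theorem MetricNear.curvature4_antisymm (h : MetricNear G y) (u v w z : E) :
    curvature4 G y u v w z = - curvature4 G y u v z w := by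
  have h1 := h.curvature4_self u v (w + z)
  have h2 := h.curvature4_self u v w
  have h3 := h.curvature4_self u v z
  simp only [curvature4, map_add, add_apply] at h1 h2 h3 ⊢
  linarith

end MetricNear

end LocalGeometry

section Naturality

variable {E : Type*} [NormedAddCommGroup E] [NormedSpace ℝ E]

/-- `φ` is a smooth local isometry near `y` from the metric `G'` to the metric `G`. -/
structure IsometryNear (G' G : E → E →L[ℝ] E →L[ℝ] ℝ) (φ : E → E) (y : E) : Prop where
  source : MetricNear G' y
  target : ∀ᶠ z in 𝓝 y, MetricNear G (φ z)
  contDiffAt : ∀ᶠ z in 𝓝 y, ContDiffAt ℝ ∞ φ z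
  surjective : ∀ᶠ z in 𝓝 y, Function.Surjective (fderiv ℝ φ z)
  pullback : ∀ᶠ z in 𝓝 y, ∀ u v, G' z u v = G (φ z) (fderiv ℝ φ z u) (fderiv ℝ φ z v)

variable {G' G : E → E →L[ℝ] E →L[ℝ] ℝ} {φ : E → E} {y : E}

theorem IsometryNear.eventually (h : IsometryNear G' G φ y) :
    ∀ᶠ z in 𝓝 y, IsometryNear G' G φ z := by
  filter_upwards [h.source.eventually, h.target.eventually_nhds, h.contDiffAt.eventually_nhds,
    h.surjective.eventually_nhds, h.pullback.eventually_nhds] with z h1 h2 h3 h4 h5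
    using ⟨h1, h2, h3, h4, h5⟩

theorem IsometryNear.differentiableAt_fderiv (h : IsometryNear G' G φ y) :
    DifferentiableAt ℝ (fderiv ℝ φ) y :=
  (h.contDiffAt.self_of_nhds.fderiv_right (m := ∞) (by simp)).differentiableAt (by simp)

theorem IsometryNear.differentiableAt (h : IsometryNear G' G φ y) : DifferentiableAt ℝ φ y :=
  h.contDiffAt.self_of_nhds.differentiableAt (by simp)

theorem IsometryNear.fderiv_fderiv_symm (h : IsometryNear G' G φ y) (u v : E) :
    fderiv ℝ (fderiv ℝ φ) y u v = fderiv ℝ (fderiv ℝ φ) y v u :=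
  (h.contDiffAt.self_of_nhds.isSymmSndFDerivAt (by simpa using ENat.LEInfty.out)).eq u v

theorem ricci_apply (G : E → E →L[ℝ] E →L[ℝ] ℝ) (y v w : E) :
    ricci G y v w = LinearMap.trace ℝ E (ricciEnd G y v w) := rfl

theorem IsometryNear.fderiv_apply (h : IsometryNear G' G φ y) (u v w : E) :
    fderiv ℝ G' y u v w = fderiv ℝ G (φ y) (fderiv ℝ φ y u) (fderiv ℝ φ y v) (fderiv ℝ φ y w)
      + G (φ y) (fderiv ℝ (fderiv ℝ φ) y u v) (fderiv ℝ φ y w)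
      + G (φ y) (fderiv ℝ φ y v) (fderiv ℝ (fderiv ℝ φ) y u w) := by
  rw [fderiv_apply₂ h.source.differentiableAt]
  have h1 : (fun z => G' z v w) =ᶠ[𝓝 y] fun z => G (φ z) (fderiv ℝ φ z v) (fderiv ℝ φ z w) := by
    filter_upwards [h.pullback] with z hz using hz v w
  have hD := h.differentiableAt_fderiv.hasFDerivAt
  have hG := HasFDerivAt.comp (g := G) (f := φ) y
    h.target.self_of_nhds.differentiableAt.hasFDerivAt h.differentiableAt.hasFDerivAt
  have h2 := (hG.clm_apply (hD.clm_apply (hasFDerivAt_const v y))).clm_apply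
    (hD.clm_apply (hasFDerivAt_const w y))
  rw [h1.fderiv_eq]
  refine (congrArg (fun L => L u) h2.fderiv).trans ?_
  simp only [Function.comp_apply, add_apply, ContinuousLinearMap.flip_apply,
    ContinuousLinearMap.comp_apply, zero_apply, map_zero, zero_add]
  ring

variable [FiniteDimensional ℝ E]

/-- The transformation law of the Christoffel symbols. -/
theorem IsometryNear.christoffel_apply (h : IsometryNear G' G φ y) (u v : E) :
    fderiv ℝ φ y (christoffel G' y u v) =
      christoffel G (φ y) (fderiv ℝ φ y u) (fderiv ℝ φ y v) + fderiv ℝ (fderiv ℝ φ) y u v := by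
  apply h.target.self_of_nhds.ext
  intro w'
  obtain ⟨w, rfl⟩ := h.surjective.self_of_nhds w'
  rw [← h.pullback.self_of_nhds, h.source.christoffel_spec, map_add, add_apply,
    h.target.self_of_nhds.christoffel_spec, christoffelLower_apply, christoffelLower_apply,
    h.fderiv_apply, h.fderiv_apply, h.fderiv_apply, h.fderiv_fderiv_symm v u,
    h.fderiv_fderiv_symm w u, h.fderiv_fderiv_symm w v,
    h.target.self_of_nhds.symm.self_of_nhds (fderiv ℝ φ y u),
    h.target.self_of_nhds.symm.self_of_nhds (fderiv ℝ φ y v) (fderiv ℝ (fderiv ℝ φ) y u w)]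
  ring

theorem IsometryNear.fderiv_christoffel_apply (h : IsometryNear G' G φ y) (w u v : E) :
    fderiv ℝ φ y (fderiv ℝ (christoffel G') y w u v) =
      fderiv ℝ (christoffel G) (φ y) (fderiv ℝ φ y w) (fderiv ℝ φ y u) (fderiv ℝ φ y v)
      + christoffel G (φ y) (fderiv ℝ (fderiv ℝ φ) y w u) (fderiv ℝ φ y v)
      + christoffel G (φ y) (fderiv ℝ φ y u) (fderiv ℝ (fderiv ℝ φ) y w v)
      + fderiv ℝ (fderiv ℝ (fderiv ℝ φ)) y w u v
      - fderiv ℝ (fderiv ℝ φ) y w (christoffel G' y u v) := by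
  have h1 : (fun z => fderiv ℝ φ z (christoffel G' z u v)) =ᶠ[𝓝 y] fun z =>
      christoffel G (φ z) (fderiv ℝ φ z u) (fderiv ℝ φ z v) + fderiv ℝ (fderiv ℝ φ) z u v := by
    filter_upwards [h.eventually] with z hz using hz.christoffel_apply u v
  have hD := h.differentiableAt_fderiv.hasFDerivAt
  have hD2 : DifferentiableAt ℝ (fderiv ℝ (fderiv ℝ φ)) y :=
    ((h.contDiffAt.self_of_nhds.fderiv_right (m := ∞) (by simp)).fderiv_right (m := ∞)
      (by simp)).differentiableAt (by simp)
  have hΓ := HasFDerivAt.comp (g := christoffel G) (f := φ) y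
    h.target.self_of_nhds.differentiableAt_christoffel.hasFDerivAt h.differentiableAt.hasFDerivAt
  have h2 := ((hΓ.clm_apply (hD.clm_apply (hasFDerivAt_const u y))).clm_apply
    (hD.clm_apply (hasFDerivAt_const v y))).add
    ((hD2.hasFDerivAt.clm_apply (hasFDerivAt_const u y)).clm_apply (hasFDerivAt_const v y))
  have h3 := hD.clm_apply ((h.source.differentiableAt_christoffel.hasFDerivAt.clm_apply
    (hasFDerivAt_const u y)).clm_apply (hasFDerivAt_const v y))
  have h4 := congrArg (fun L => L w) ((h2.congr_of_eventuallyEq h1).unique h3)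
  simp only [Function.comp_apply, add_apply, ContinuousLinearMap.flip_apply,
    ContinuousLinearMap.comp_apply, zero_apply, map_zero, zero_add] at h4
  rw [eq_sub_iff_add_eq, ← h4]
  abel

/-- The curvature is natural under isometries. -/
theorem IsometryNear.curvature_apply (h : IsometryNear G' G φ y) (u v z : E) :
    fderiv ℝ φ y (curvature G' y u v z) =
      curvature G (φ y) (fderiv ℝ φ y u) (fderiv ℝ φ y v) (fderiv ℝ φ y z) := by
  have h3 : fderiv ℝ (fderiv ℝ (fderiv ℝ φ)) y u v z = fderiv ℝ (fderiv ℝ (fderiv ℝ φ)) y v u z :=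
    congrArg (fun L => L z) (((h.contDiffAt.self_of_nhds.fderiv_right (m := ∞)
      (by simp)).isSymmSndFDerivAt (by simpa using ENat.LEInfty.out)).eq u v)
  simp only [RiemInv.curvature_apply, map_add, map_sub, h.fderiv_christoffel_apply,
    h.christoffel_apply, h3, h.fderiv_fderiv_symm v u]
  abel

theorem IsometryNear.curvature4_apply (h : IsometryNear G' G φ y) (u v w z : E) :
    curvature4 G' y u v w z = curvature4 G (φ y) (fderiv ℝ φ y u) (fderiv ℝ φ y v)
      (fderiv ℝ φ y w) (fderiv ℝ φ y z) := by
  rw [curvature4, curvature4, ← h.curvature_apply, h.pullback.self_of_nhds]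

theorem IsometryNear.exists_equiv (h : IsometryNear G' G φ y) :
    ∃ e : E ≃ₗ[ℝ] E, ∀ v, e v = fderiv ℝ φ y v :=
  ⟨LinearEquiv.ofBijective (fderiv ℝ φ y).toLinearMap
    ⟨LinearMap.injective_iff_surjective.2 h.surjective.self_of_nhds, h.surjective.self_of_nhds⟩,
    fun _ => rfl⟩

theorem IsometryNear.ricci_apply (h : IsometryNear G' G φ y) (v w : E) :
    ricci G' y v w = ricci G (φ y) (fderiv ℝ φ y v) (fderiv ℝ φ y w) := by
  obtain ⟨e, he⟩ := h.exists_equiv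
  rw [RiemInv.ricci_apply, RiemInv.ricci_apply, ← LinearMap.trace_conj' (ricciEnd G' y v w) e]
  congr 1
  ext u
  simp [LinearEquiv.conj_apply, ricciEnd, he, h.curvature_apply]
  rw [← he (e.symm u), e.apply_symm_apply]

/-- The Ricci tensor as an endomorphism. -/
def ricciSharp (G : E → E →L[ℝ] E →L[ℝ] ℝ) (y : E) : E →ₗ[ℝ] E :=
  (G y).inverse.toLinearMap ∘ₗ (LinearMap.toContinuousLinearMap.toLinearMap ∘ₗ ricci G y)

theorem MetricNear.ricciSharp_spec (h : MetricNear G y) (v w : E) :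
    G y (ricciSharp G y v) w = ricci G y v w := by
  simp [ricciSharp, h.apply_inverse]

theorem scal_eq (G : E → E →L[ℝ] E →L[ℝ] ℝ) (y : E) :
    scal G y = LinearMap.trace ℝ E (ricciSharp G y) := rfl

theorem IsometryNear.scal_eq (h : IsometryNear G' G φ y) : scal G' y = scal G (φ y) := by
  obtain ⟨e, he⟩ := h.exists_equiv
  rw [RiemInv.scal_eq, RiemInv.scal_eq, ← LinearMap.trace_conj' (ricciSharp G' y) e]
  congr 1
  ext u
  apply h.target.self_of_nhds.ext
  intro w
  obtain ⟨w, rfl⟩ := e.surjective w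
  obtain ⟨u, rfl⟩ := e.surjective u
  rw [h.target.self_of_nhds.ricciSharp_spec]
  simp only [LinearEquiv.conj_apply, LinearMap.comp_apply, LinearEquiv.coe_coe,
    LinearEquiv.symm_apply_apply]
  rw [he, he, he, ← h.pullback.self_of_nhds, h.source.ricciSharp_spec, h.ricci_apply]

end Naturality

section Product

variable {E₁ : Type*} [NormedAddCommGroup E₁] [NormedSpace ℝ E₁]
  {E₂ : Type*} [NormedAddCommGroup E₂] [NormedSpace ℝ E₂]

/-- The metric `a G₁ + b G₂` on a product. -/
def prodForm (a b : ℝ) (B₁ : E₁ →L[ℝ] E₁ →L[ℝ] ℝ) (B₂ : E₂ →L[ℝ] E₂ →L[ℝ] ℝ) :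
    E₁ × E₂ →L[ℝ] E₁ × E₂ →L[ℝ] ℝ :=
  a • B₁.bilinearComp (ContinuousLinearMap.fst ℝ E₁ E₂) (ContinuousLinearMap.fst ℝ E₁ E₂) +
    b • B₂.bilinearComp (ContinuousLinearMap.snd ℝ E₁ E₂) (ContinuousLinearMap.snd ℝ E₁ E₂)

theorem prodForm_apply (a b : ℝ) (B₁ : E₁ →L[ℝ] E₁ →L[ℝ] ℝ) (B₂ : E₂ →L[ℝ] E₂ →L[ℝ] ℝ)
    (u v : E₁ × E₂) : prodForm a b B₁ B₂ u v = a * B₁ u.1 v.1 + b * B₂ u.2 v.2 := by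
  simp [prodForm]

theorem prodForm_pos {a b : ℝ} (ha : 0 < a) (hb : 0 < b) {B₁ : E₁ →L[ℝ] E₁ →L[ℝ] ℝ}
    {B₂ : E₂ →L[ℝ] E₂ →L[ℝ] ℝ} (h₁ : ∀ v, v ≠ 0 → 0 < B₁ v v) (h₂ : ∀ v, v ≠ 0 → 0 < B₂ v v)
    (v : E₁ × E₂) (hv : v ≠ 0) : 0 < prodForm a b B₁ B₂ v v := by
  rw [prodForm_apply]
  have h₁' : 0 ≤ B₁ v.1 v.1 := by
    by_cases h : v.1 = 0
    · simp [h]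
    · exact (h₁ _ h).le
  have h₂' : 0 ≤ B₂ v.2 v.2 := by
    by_cases h : v.2 = 0
    · simp [h]
    · exact (h₂ _ h).le
  by_cases h : v.1 = 0
  · have : v.2 ≠ 0 := fun h' => hv (Prod.ext h h')
    have := mul_pos hb (h₂ _ this)
    have := mul_nonneg ha.le h₁'
    linarith
  · have := mul_pos ha (h₁ _ h)
    have := mul_nonneg hb.le h₂'
    linarith

/-- The product metric `a G₁ + b G₂` in coordinates. -/
def prodMetric (a b : ℝ) (G₁ : E₁ → E₁ →L[ℝ] E₁ →L[ℝ] ℝ) (G₂ : E₂ → E₂ →L[ℝ] E₂ →L[ℝ] ℝ)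
    (z : E₁ × E₂) : E₁ × E₂ →L[ℝ] E₁ × E₂ →L[ℝ] ℝ :=
  prodForm a b (G₁ z.1) (G₂ z.2)

variable {G₁ : E₁ → E₁ →L[ℝ] E₁ →L[ℝ] ℝ} {G₂ : E₂ → E₂ →L[ℝ] E₂ →L[ℝ] ℝ} {a b : ℝ}
  {y : E₁ × E₂}

set_option maxSynthPendingDepth 5 in
theorem contDiff_bilinearComp {E F : Type*} [NormedAddCommGroup E] [NormedSpace ℝ E]
    [NormedAddCommGroup F] [NormedSpace ℝ F] (A : F →L[ℝ] E) :
    ContDiff ℝ ∞ (fun B : E →L[ℝ] E →L[ℝ] ℝ => B.bilinearComp A A) := by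
  have h₁ := (ContinuousLinearMap.flipₗᵢ ℝ F E ℝ).contDiff.comp
    ((contDiff_id (n := ∞) (E := E →L[ℝ] E →L[ℝ] ℝ) (𝕜 := ℝ)).clm_comp (contDiff_const (c := A)))
  exact (ContinuousLinearMap.flipₗᵢ ℝ F F ℝ).contDiff.comp (h₁.clm_comp (contDiff_const (c := A)))

theorem MetricNear.prod (h₁ : MetricNear G₁ y.1) (h₂ : MetricNear G₂ y.2) (ha : 0 < a)
    (hb : 0 < b) : MetricNear (prodMetric a b G₁ G₂) y := by
  have e₁ := (continuousAt_fst (p := y)).eventually h₁.eventually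
  have e₂ := (continuousAt_snd (p := y)).eventually h₂.eventually
  refine ⟨?_, ?_, ?_⟩
  · filter_upwards [e₁, e₂] with z h1 h2
    have t₁ := (contDiff_bilinearComp (ContinuousLinearMap.fst ℝ E₁ E₂)).contDiffAt.comp z
      (ContDiffAt.comp z h1.contDiffAt.self_of_nhds contDiffAt_fst)
    have t₂ := (contDiff_bilinearComp (ContinuousLinearMap.snd ℝ E₁ E₂)).contDiffAt.comp z
      (ContDiffAt.comp z h2.contDiffAt.self_of_nhds contDiffAt_snd)
    exact (t₁.const_smul a).add (t₂.const_smul b)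
  · filter_upwards [e₁, e₂] with z h1 h2 u v
    rw [prodMetric, prodForm_apply, prodForm_apply, h1.symm.self_of_nhds, h2.symm.self_of_nhds]
  · filter_upwards [e₁, e₂] with z h1 h2
    exact prodForm_pos ha hb h1.pos.self_of_nhds h2.pos.self_of_nhds

theorem fderiv_prodMetric (h₁ : MetricNear G₁ y.1) (h₂ : MetricNear G₂ y.2) (ha : 0 < a)
    (hb : 0 < b) (u v w : E₁ × E₂) :
    fderiv ℝ (prodMetric a b G₁ G₂) y u v w =
      a * fderiv ℝ G₁ y.1 u.1 v.1 w.1 + b * fderiv ℝ G₂ y.2 u.2 v.2 w.2 := by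
  rw [fderiv_apply₂ (h₁.prod h₂ ha hb).differentiableAt]
  have p₁ : HasFDerivAt Prod.fst (ContinuousLinearMap.fst ℝ E₁ E₂) y := hasFDerivAt_fst
  have c₁ := HasFDerivAt.comp (g := G₁) y h₁.differentiableAt.hasFDerivAt p₁
  have d₁ := ((c₁.clm_apply
    (hasFDerivAt_const v.1 y)).clm_apply (hasFDerivAt_const w.1 y)).const_mul a
  have p₂ : HasFDerivAt Prod.snd (ContinuousLinearMap.snd ℝ E₁ E₂) y := hasFDerivAt_snd
  have c₂ := HasFDerivAt.comp (g := G₂) y h₂.differentiableAt.hasFDerivAt p₂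
  have d₂ := ((c₂.clm_apply
    (hasFDerivAt_const v.2 y)).clm_apply (hasFDerivAt_const w.2 y)).const_mul b
  have : (fun z => prodMetric a b G₁ G₂ z v w) =
      fun z => a * G₁ z.1 v.1 w.1 + b * G₂ z.2 v.2 w.2 := by
    ext z; rw [prodMetric, prodForm_apply]
  rw [this]
  refine (congrArg (fun L => L u) (d₁.add d₂).fderiv).trans ?_
  simp

variable [FiniteDimensional ℝ E₁] [FiniteDimensional ℝ E₂]

theorem christoffel_prodMetric (h₁ : MetricNear G₁ y.1) (h₂ : MetricNear G₂ y.2) (ha : 0 < a)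
    (hb : 0 < b) (u v : E₁ × E₂) :
    christoffel (prodMetric a b G₁ G₂) y u v =
      (christoffel G₁ y.1 u.1 v.1, christoffel G₂ y.2 u.2 v.2) := by
  have h := h₁.prod h₂ ha hb
  apply h.ext
  intro w
  rw [h.christoffel_spec, christoffelLower_apply, fderiv_prodMetric h₁ h₂ ha hb,
    fderiv_prodMetric h₁ h₂ ha hb, fderiv_prodMetric h₁ h₂ ha hb, prodMetric, prodForm_apply,
    h₁.christoffel_spec, h₂.christoffel_spec, christoffelLower_apply, christoffelLower_apply]
  ring

theorem fderiv_christoffel_prodMetric (h₁ : MetricNear G₁ y.1) (h₂ : MetricNear G₂ y.2)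
    (ha : 0 < a) (hb : 0 < b) (w u v : E₁ × E₂) :
    fderiv ℝ (christoffel (prodMetric a b G₁ G₂)) y w u v =
      (fderiv ℝ (christoffel G₁) y.1 w.1 u.1 v.1, fderiv ℝ (christoffel G₂) y.2 w.2 u.2 v.2) := by
  have h1 : (fun z => christoffel (prodMetric a b G₁ G₂) z u v) =ᶠ[𝓝 y]
      fun z => (christoffel G₁ z.1 u.1 v.1, christoffel G₂ z.2 u.2 v.2) := by
    filter_upwards [(continuousAt_fst (p := y)).eventually h₁.eventually,
      (continuousAt_snd (p := y)).eventually h₂.eventually] with z h1 h2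
    exact christoffel_prodMetric h1 h2 ha hb u v
  have d := (((h₁.prod h₂ ha hb).differentiableAt_christoffel.hasFDerivAt.clm_apply
    (hasFDerivAt_const u y)).clm_apply (hasFDerivAt_const v y))
  have p₁ : HasFDerivAt Prod.fst (ContinuousLinearMap.fst ℝ E₁ E₂) y := hasFDerivAt_fst
  have c₁ := HasFDerivAt.comp (g := christoffel G₁) y h₁.differentiableAt_christoffel.hasFDerivAt p₁
  have d₁ := ((c₁.clm_apply
    (hasFDerivAt_const u.1 y)).clm_apply (hasFDerivAt_const v.1 y))
  have p₂ : HasFDerivAt Prod.snd (ContinuousLinearMap.snd ℝ E₁ E₂) y := hasFDerivAt_snd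
  have c₂ := HasFDerivAt.comp (g := christoffel G₂) y h₂.differentiableAt_christoffel.hasFDerivAt p₂
  have d₂ := ((c₂.clm_apply
    (hasFDerivAt_const u.2 y)).clm_apply (hasFDerivAt_const v.2 y))
  have h4 := congrArg (fun L => L w) (((d₁.prodMk d₂).congr_of_eventuallyEq h1).unique d)
  simpa using h4.symm

theorem curvature_prodMetric (h₁ : MetricNear G₁ y.1) (h₂ : MetricNear G₂ y.2) (ha : 0 < a)
    (hb : 0 < b) (u v z : E₁ × E₂) :
    curvature (prodMetric a b G₁ G₂) y u v z =
      (curvature G₁ y.1 u.1 v.1 z.1, curvature G₂ y.2 u.2 v.2 z.2) := by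
  simp only [curvature_apply, christoffel_prodMetric h₁ h₂ ha hb,
    fderiv_christoffel_prodMetric h₁ h₂ ha hb]
  rfl

theorem curvature4_prodMetric (h₁ : MetricNear G₁ y.1) (h₂ : MetricNear G₂ y.2) (ha : 0 < a)
    (hb : 0 < b) (u v w z : E₁ × E₂) :
    curvature4 (prodMetric a b G₁ G₂) y u v w z =
      a * curvature4 G₁ y.1 u.1 v.1 w.1 z.1 + b * curvature4 G₂ y.2 u.2 v.2 w.2 z.2 := by
  rw [curvature4, curvature_prodMetric h₁ h₂ ha hb, prodMetric, prodForm_apply]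
  rfl

theorem ricci_prodMetric (h₁ : MetricNear G₁ y.1) (h₂ : MetricNear G₂ y.2) (ha : 0 < a)
    (hb : 0 < b) (v w : E₁ × E₂) :
    ricci (prodMetric a b G₁ G₂) y v w = ricci G₁ y.1 v.1 w.1 + ricci G₂ y.2 v.2 w.2 := by
  rw [ricci_apply, ricci_apply, ricci_apply, ← LinearMap.trace_prodMap']
  congr 1
  apply LinearMap.ext
  intro u
  exact curvature_prodMetric h₁ h₂ ha hb u v w

theorem scal_prodMetric (h₁ : MetricNear G₁ y.1) (h₂ : MetricNear G₂ y.2) (ha : 0 < a)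
    (hb : 0 < b) :
    scal (prodMetric a b G₁ G₂) y = a⁻¹ * scal G₁ y.1 + b⁻¹ * scal G₂ y.2 := by
  have h := h₁.prod h₂ ha hb
  rw [scal_eq, scal_eq, scal_eq, ← smul_eq_mul, ← smul_eq_mul, ← map_smul, ← map_smul,
    ← LinearMap.trace_prodMap']
  congr 1
  apply LinearMap.ext
  intro u
  apply h.ext
  intro w
  rw [h.ricciSharp_spec, ricci_prodMetric h₁ h₂ ha hb, prodMetric, prodForm_apply]
  simp only [LinearMap.prodMap_apply, LinearMap.smul_apply, map_smul, smul_apply, smul_eq_mul,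
    h₁.ricciSharp_spec, h₂.ricciSharp_spec]
  rw [mul_inv_cancel_left₀ ha.ne', mul_inv_cancel_left₀ hb.ne']

end Product

section Bivectors

variable {E : Type*} [NormedAddCommGroup E] [NormedSpace ℝ E]

/-- `S` is bilinear and antisymmetric. -/
structure AltBilin {V : Type*} [AddCommGroup V] [Module ℝ V] (S : E → E → V) : Prop where
  add_left : ∀ u u' v, S (u + u') v = S u v + S u' v
  smul_left : ∀ (c : ℝ) u v, S (c • u) v = c • S u v
  antisymm : ∀ u v, S u v = - S v u

/-- `T` is quadrilinear, antisymmetric in the first two and in the last two arguments. -/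
structure CurvatureLike (T : E → E → E → E → ℝ) : Prop where
  left : ∀ w z, AltBilin fun u v => T u v w z
  right : ∀ u v, AltBilin (T u v)

variable {ι : Type*} (b : Module.Basis ι ℝ E)

/-- The coordinates of the bivector `∑ a, x a ∧ y a`. -/
def wedgeCoord {κ : Type*} [Fintype κ] (x y : κ → E) (i j : ι) : ℝ :=
  ∑ a, (b.repr (x a) i * b.repr (y a) j - b.repr (x a) j * b.repr (y a) i)

theorem wedgeCoord_antisymm {κ : Type*} [Fintype κ] (x y : κ → E) (i j : ι) :
    wedgeCoord b x y i j = - wedgeCoord b x y j i := by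
  simp only [wedgeCoord, ← Finset.sum_neg_distrib, neg_sub]

variable [Fintype ι]

section AltBilin

variable {V : Type*} [AddCommGroup V] [Module ℝ V] {S : E → E → V}

theorem AltBilin.add_right (h : AltBilin S) (u v v' : E) : S u (v + v') = S u v + S u v' := by
  rw [h.antisymm, h.add_left, h.antisymm v, h.antisymm v']; abel

theorem AltBilin.smul_right (h : AltBilin S) (c : ℝ) (u v : E) : S u (c • v) = c • S u v := by
  rw [h.antisymm, h.smul_left, h.antisymm v, smul_neg, neg_neg]

theorem AltBilin.apply_eq_sum (h : AltBilin S) (u v : E) :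
    S u v = ∑ i, ∑ j, (b.repr u i * b.repr v j) • S (b i) (b j) := by
  let L : E →ₗ[ℝ] E →ₗ[ℝ] V := LinearMap.mk₂ ℝ S h.add_left h.smul_left h.add_right h.smul_right
  change L u v = ∑ i, ∑ j, (b.repr u i * b.repr v j) • L (b i) (b j)
  conv_lhs => rw [← b.sum_repr u, ← b.sum_repr v]
  simp only [map_sum, LinearMap.sum_apply, map_smul, LinearMap.smul_apply, mul_smul]
  rw [Finset.sum_comm]
  refine Finset.sum_congr rfl fun i _ => ?_
  rw [Finset.smul_sum]
  exact Finset.sum_congr rfl fun j _ => smul_comm _ _ _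

theorem AltBilin.sum_eq (h : AltBilin S) {κ : Type*} [Fintype κ] (x y : κ → E) :
    ∑ a, S (x a) (y a) = (1 / 2 : ℝ) • ∑ i, ∑ j, wedgeCoord b x y i j • S (b i) (b j) := by
  have h2 : ∀ u v : E, S u v = (1 / 2 : ℝ) • ∑ i, ∑ j,
      (b.repr u i * b.repr v j - b.repr u j * b.repr v i) • S (b i) (b j) := by
    intro u v
    have h3 := h.apply_eq_sum b u v
    have h4 : S u v = - ∑ i, ∑ j, (b.repr u j * b.repr v i) • S (b i) (b j) := by
      rw [h3, Finset.sum_comm, ← Finset.sum_neg_distrib]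
      refine Finset.sum_congr rfl fun i _ => ?_
      rw [← Finset.sum_neg_distrib]
      refine Finset.sum_congr rfl fun j _ => ?_
      rw [h.antisymm (b j), smul_neg]
    simp only [sub_smul, Finset.sum_sub_distrib]
    rw [← h3, sub_eq_add_neg, ← h4, ← two_smul ℝ, smul_smul]
    norm_num
  simp only [wedgeCoord, Finset.sum_smul]
  rw [Finset.sum_congr rfl fun a _ => h2 (x a) (y a), ← Finset.smul_sum, Finset.sum_comm]
  congr 1
  exact Finset.sum_congr rfl fun i _ => Finset.sum_comm

end AltBilin

theorem update_pair_zero {E : Type*} (u v w : E) : Function.update ![u, v] 0 w = ![w, v] := by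
  ext i
  fin_cases i <;> simp

theorem altBilin_ιMulti : AltBilin fun u v : E => exteriorPower.ιMulti ℝ 2 ![u, v] where
  add_left u u' v := by
    have := (exteriorPower.ιMulti ℝ 2 (M := E)).map_update_add ![u, v] 0 u u'
    simpa only [update_pair_zero] using this
  smul_left c u v := by
    have := (exteriorPower.ιMulti ℝ 2 (M := E)).map_update_smul ![u, v] 0 c u
    simpa only [update_pair_zero] using this
  antisymm u v := by
    have := (exteriorPower.ιMulti ℝ 2 (M := E)).map_swap ![v, u] (i := 0) (j := 1) (by simp)
    rw [← this]
    congr 1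
    ext i
    fin_cases i <;> simp

theorem sum_ιMulti_eq_zero_iff {κ : Type*} [Fintype κ] (x y : κ → E) :
    ∑ a, exteriorPower.ιMulti ℝ 2 ![x a, y a] = 0 ↔ wedgeCoord b x y = 0 := by
  constructor
  · intro h
    ext i j
    let A : E [⋀^Fin 2]→ₗ[ℝ] ℝ := (Matrix.detRowAlternating (R := ℝ) (n := Fin 2)).compLinearMap
      (LinearMap.pi ![b.coord i, b.coord j])
    have hA := congrArg (exteriorPower.alternatingMapLinearEquiv A) h
    rw [map_sum, map_zero] at hA
    rw [Pi.zero_apply, Pi.zero_apply, ← hA, wedgeCoord]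
    refine Finset.sum_congr rfl fun a _ => ?_
    rw [exteriorPower.alternatingMapLinearEquiv_apply_ιMulti]
    refine Eq.trans ?_ (Matrix.det_fin_two (Matrix.of fun k =>
      LinearMap.pi ![b.coord i, b.coord j] (![x a, y a] k))).symm
    simp
  · intro h
    rw [altBilin_ιMulti.sum_eq b x y]
    simp [h]

/-- The value of a tensor on the bivector with coordinates `W`, up to a factor. -/
def bivectorForm (T : E → E → E → E → ℝ) (W : ι → ι → ℝ) : ℝ :=
  ∑ i, ∑ j, ∑ k, ∑ l, W i j * (W k l * T (b i) (b j) (b k) (b l))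

theorem CurvatureLike.sum_eq {T : E → E → E → E → ℝ} (h : CurvatureLike T) {κ : Type*} [Fintype κ]
    (x y : κ → E) :
    ∑ a, ∑ a', T (x a) (y a) (x a') (y a') = (1 / 4 : ℝ) * bivectorForm b T (wedgeCoord b x y) := by
  rw [Finset.sum_comm]
  rw [Finset.sum_congr rfl fun a _ => (h.left (x a) (y a)).sum_eq b x y]
  simp only [smul_eq_mul]
  rw [← Finset.mul_sum, Finset.sum_comm]
  rw [bivectorForm]
  have h1 : ∀ i, ∑ a, ∑ j, wedgeCoord b x y i j * T (b i) (b j) (x a) (y a) =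
      (1 / 2) * ∑ j, ∑ k, ∑ l,
        wedgeCoord b x y i j * (wedgeCoord b x y k l * T (b i) (b j) (b k) (b l)) := by
    intro i
    rw [Finset.sum_comm, Finset.mul_sum]
    refine Finset.sum_congr rfl fun j _ => ?_
    rw [← Finset.mul_sum, (h.right (b i) (b j)).sum_eq b x y]
    simp only [smul_eq_mul, Finset.mul_sum]
    refine Finset.sum_congr rfl fun k _ => Finset.sum_congr rfl fun l _ => by ring
  rw [Finset.sum_congr rfl fun i _ => h1 i, ← Finset.mul_sum]
  ring

theorem bivectorForm_smul (T : E → E → E → E → ℝ) (c : ℝ) (W : ι → ι → ℝ) :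
    bivectorForm b T (c • W) = c ^ 2 * bivectorForm b T W := by
  simp only [bivectorForm, Finset.mul_sum, Pi.smul_apply, smul_eq_mul]
  refine Finset.sum_congr rfl fun i _ => Finset.sum_congr rfl fun j _ =>
    Finset.sum_congr rfl fun k _ => Finset.sum_congr rfl fun l _ => by ring

theorem CurvatureLike.posDef_iff {T : E → E → E → E → ℝ} (h : CurvatureLike T) :
    PosDefOnBivectors T ↔
      ∀ W : ι → ι → ℝ, (∀ i j, W i j = - W j i) → W ≠ 0 → 0 < bivectorForm b T W := by
  classical
  constructor
  · intro hT W hW hne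
    let e := Fintype.equivFin (ι × ι)
    let x : Fin (Fintype.card (ι × ι)) → E := fun a => W (e.symm a).1 (e.symm a).2 • b (e.symm a).1
    let y : Fin (Fintype.card (ι × ι)) → E := fun a => b (e.symm a).2
    have hxy : wedgeCoord b x y = (2 : ℝ) • W := by
      ext i j
      rw [wedgeCoord, ← e.sum_comp, Fintype.sum_prod_type]
      simp [x, y, Finsupp.single_apply, Finset.sum_sub_distrib]
      rw [hW j i]; ring
    have := hT _ x y (by
      rw [ne_eq, sum_ιMulti_eq_zero_iff b, hxy]
      simpa using hne)
    rw [h.sum_eq b, hxy, bivectorForm_smul] at this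
    linarith
  · intro H k x y hω
    rw [h.sum_eq b]
    have := H _ (wedgeCoord_antisymm b x y) (by rwa [ne_eq, ← sum_ιMulti_eq_zero_iff b])
    linarith

theorem CurvatureLike.sum_nonneg {T : E → E → E → E → ℝ} (h : CurvatureLike T)
    [FiniteDimensional ℝ E]
    (hT : PosDefOnBivectors T) {k : ℕ} (x y : Fin k → E) :
    0 ≤ ∑ a, ∑ a', T (x a) (y a) (x a') (y a') := by
  by_cases hω : ∑ a, exteriorPower.ιMulti ℝ 2 ![x a, y a] = 0
  · rw [h.sum_eq (Module.finBasis ℝ E), (sum_ιMulti_eq_zero_iff (Module.finBasis ℝ E) x y).1 hω]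
    simp [bivectorForm]
  · exact (hT k x y hω).le

/-- Positive definiteness on bivectors is an open condition. -/
theorem PosDefOnBivectors.eventually {X : Type*} [TopologicalSpace X] {x₀ : X}
    {T : X → E → E → E → E → ℝ} (hT : ∀ᶠ x in 𝓝 x₀, CurvatureLike (T x))
    (hc : ∀ i j k l, ContinuousAt (fun x => T x (b i) (b j) (b k) (b l)) x₀)
    (h : PosDefOnBivectors (T x₀)) : ∀ᶠ x in 𝓝 x₀, PosDefOnBivectors (T x) := by
  let K : Set (ι → ι → ℝ) := Metric.sphere 0 1 ∩ {W | ∀ i j, W i j = - W j i}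
  have hK : IsCompact K := by
    refine (isCompact_sphere 0 1).inter_right ?_
    simp only [Set.ofPred_forall]
    exact isClosed_iInter fun i => isClosed_iInter fun j =>
      isClosed_eq (by fun_prop) (by fun_prop)
  have hpos : ∀ W ∈ K, 0 < bivectorForm b (T x₀) W := fun W hW =>
    (hT.self_of_nhds.posDef_iff b).1 h W hW.2 (by
      rintro rfl
      simpa using hW.1)
  have hev : ∀ᶠ x in 𝓝 x₀, ∀ W ∈ K, 0 < bivectorForm b (T x) W := by
    refine hK.eventually_forall_of_forall_eventually fun W hW => ?_
    have hcont : ContinuousAt (fun p : X × (ι → ι → ℝ) => bivectorForm b (T p.1) p.2) (x₀, W) := by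
      unfold bivectorForm
      refine tendsto_finsetSum _ fun i _ => tendsto_finsetSum _ fun j _ =>
        tendsto_finsetSum _ fun k _ => tendsto_finsetSum _ fun l _ => ?_
      have h1 : ∀ i j, ContinuousAt (fun p : X × (ι → ι → ℝ) => p.2 i j) (x₀, W) := fun i j => by
        fun_prop
      exact (h1 i j).mul ((h1 k l).mul
        (ContinuousAt.comp (f := Prod.fst) (x := (x₀, W)) (hc i j k l) continuousAt_fst))
    exact hcont.eventually (lt_mem_nhds (hpos W hW))
  filter_upwards [hT, hev] with x hx hxK
  rw [hx.posDef_iff b]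
  intro W hW hne
  have hn : ‖W‖ ≠ 0 := norm_ne_zero_iff.2 hne
  have := hxK (‖W‖⁻¹ • W) ⟨by simp [norm_smul, hn], fun i j => by simp [hW i j]⟩
  rw [bivectorForm_smul] at this
  exact pos_of_mul_pos_right this (by positivity)

/-- A positive definite form is diagonal in some basis. -/
theorem exists_diagonal_basis [FiniteDimensional ℝ E] {B : E →L[ℝ] E →L[ℝ] ℝ}
    (hs : ∀ u v, B u v = B v u) (hB : ∀ v, v ≠ 0 → 0 < B v v) :
    ∃ (b : Module.Basis (Fin (Module.finrank ℝ E)) ℝ E) (c : Fin (Module.finrank ℝ E) → ℝ),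
      (∀ i, 0 < c i) ∧ ∀ u v, B u v = ∑ i, c i * (b.repr u i * b.repr v i) := by
  let L : LinearMap.BilinForm ℝ E := LinearMap.mk₂ ℝ (fun u v => B u v) (by simp) (by simp)
    (by simp) (by simp)
  obtain ⟨b, hb⟩ := LinearMap.BilinForm.exists_orthogonal_basis (B := L) ⟨fun u v => hs u v⟩
  refine ⟨b, fun i => B (b i) (b i), fun i => hB _ (b.ne_zero i), fun u v => ?_⟩
  change L u v = _
  conv_lhs => rw [← b.sum_repr u, ← b.sum_repr v]
  simp only [map_sum, LinearMap.sum_apply, map_smul, LinearMap.smul_apply, smul_eq_mul]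
  refine Finset.sum_congr rfl fun i _ => ?_
  rw [Finset.sum_eq_single i]
  · change _ * (_ * B (b i) (b i)) = _
    ring
  · intro j _ hj
    have : L (b j) (b i) = 0 := hb hj
    simp [this]
  · simp

theorem altBilin_add {V : Type*} [AddCommGroup V] [Module ℝ V] {S S' : E → E → V}
    (h : AltBilin S) (h' : AltBilin S') : AltBilin fun u v => S u v + S' u v where
  add_left u u' v := by rw [h.add_left, h'.add_left]; abel
  smul_left c u v := by rw [h.smul_left, h'.smul_left, smul_add]
  antisymm u v := by rw [h.antisymm, h'.antisymm u]; abel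

theorem altBilin_smul {V : Type*} [AddCommGroup V] [Module ℝ V] {S : E → E → V}
    (h : AltBilin S) (c : ℝ) : AltBilin fun u v => c • S u v where
  add_left u u' v := by rw [h.add_left, smul_add]
  smul_left d u v := by rw [h.smul_left, smul_comm]
  antisymm u v := by rw [h.antisymm, smul_neg]

theorem CurvatureLike.add {T T' : E → E → E → E → ℝ} (h : CurvatureLike T)
    (h' : CurvatureLike T') : CurvatureLike fun u v w z => T u v w z + T' u v w z :=
  ⟨fun w z => altBilin_add (h.left w z) (h'.left w z),
    fun u v => altBilin_add (h.right u v) (h'.right u v)⟩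

theorem CurvatureLike.const_mul {T : E → E → E → E → ℝ} (h : CurvatureLike T) (c : ℝ) :
    CurvatureLike fun u v w z => c * T u v w z :=
  ⟨fun w z => altBilin_smul (h.left w z) c, fun u v => altBilin_smul (h.right u v) c⟩

theorem curvatureLike_kulkarniNomizu (B : E →L[ℝ] E →L[ℝ] ℝ) :
    CurvatureLike fun u v w z => kulkarniNomizu B B u v w z / 2 where
  left w z := ⟨fun u u' v => by simp [kulkarniNomizu]; ring,
    fun c u v => by simp [kulkarniNomizu]; ring, fun u v => by simp [kulkarniNomizu]; ring⟩
  right u v := ⟨fun w w' z => by simp [kulkarniNomizu]; ring,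
    fun c w z => by simp [kulkarniNomizu]; ring, fun w z => by simp [kulkarniNomizu]; ring⟩

theorem posDef_kulkarniNomizu [FiniteDimensional ℝ E] {B : E →L[ℝ] E →L[ℝ] ℝ}
    (hs : ∀ u v, B u v = B v u) (hB : ∀ v, v ≠ 0 → 0 < B v v) :
    PosDefOnBivectors fun u v w z => kulkarniNomizu B B u v w z / 2 := by
  obtain ⟨b, c, hc, hBc⟩ := exists_diagonal_basis hs hB
  rw [(curvatureLike_kulkarniNomizu B).posDef_iff b]
  intro W hW hne
  have hb : ∀ i j, B (b i) (b j) = if i = j then c j else 0 := by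
    intro i j
    rw [hBc]
    simp [Finsupp.single_apply]
  have : bivectorForm b (fun u v w z => kulkarniNomizu B B u v w z / 2) W =
      ∑ i, ∑ j, 2 * (c i * c j * W i j ^ 2) := by
    unfold bivectorForm
    refine Finset.sum_congr rfl fun i _ => Finset.sum_congr rfl fun j _ => ?_
    have : ∀ k l, W i j * (W k l * (kulkarniNomizu B B (b i) (b j) (b k) (b l) / 2)) =
        (if i = k then (if j = l then c k * c l * W i j * W k l else 0) else 0) -
        (if i = l then (if j = k then c k * c l * W i j * W k l else 0) else 0) := by
      intro k l
      simp only [kulkarniNomizu, hb]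
      split_ifs <;> ring
    simp only [this, Finset.sum_sub_distrib, Finset.sum_ite_eq, Finset.mem_univ, if_true]
    rw [Finset.sum_comm]
    simp only [Finset.sum_ite_eq, Finset.mem_univ, if_true]
    rw [hW j i]; ring
  rw [this]
  have hn : ∀ i j, 0 ≤ 2 * (c i * c j * W i j ^ 2) := fun i j => by
    have := hc i; have := hc j; positivity
  obtain ⟨i, hi⟩ := Function.ne_iff.1 hne
  obtain ⟨j, hj⟩ := Function.ne_iff.1 hi
  refine Finset.sum_pos' (fun i _ => Finset.sum_nonneg fun j _ => hn i j)
    ⟨i, Finset.mem_univ i, Finset.sum_pos' (fun j _ => hn i j) ⟨j, Finset.mem_univ j, ?_⟩⟩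
  have := hc i; have := hc j
  have : 0 < W i j ^ 2 := by
    have : W i j ≠ 0 := hj
    positivity
  positivity

end Bivectors

section Product

variable {E₁ : Type*} [NormedAddCommGroup E₁] [NormedSpace ℝ E₁]
  {E₂ : Type*} [NormedAddCommGroup E₂] [NormedSpace ℝ E₂]

/-- The mixed part of the Kulkarni-Nomizu square of a product metric is a weighted sum of
squares. -/
theorem sum_mixed_eq {ι₁ ι₂ κ : Type*} [Fintype ι₁] [Fintype ι₂] [Fintype κ]
    (b₁ : Module.Basis ι₁ ℝ E₁) (b₂ : Module.Basis ι₂ ℝ E₂) (c₁ : ι₁ → ℝ) (c₂ : ι₂ → ℝ)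
    {B₁ : E₁ →L[ℝ] E₁ →L[ℝ] ℝ} {B₂ : E₂ →L[ℝ] E₂ →L[ℝ] ℝ}
    (h₁ : ∀ u v, B₁ u v = ∑ i, c₁ i * (b₁.repr u i * b₁.repr v i))
    (h₂ : ∀ u v, B₂ u v = ∑ i, c₂ i * (b₂.repr u i * b₂.repr v i)) (x y : κ → E₁ × E₂) :
    ∑ a, ∑ a', (B₁ (x a).1 (x a').1 * B₂ (y a).2 (y a').2
        + B₂ (x a).2 (x a').2 * B₁ (y a).1 (y a').1 - B₁ (x a).1 (y a').1 * B₂ (y a).2 (x a').2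
        - B₂ (x a).2 (y a').2 * B₁ (y a).1 (x a').1) =
      ∑ i, ∑ j, c₁ i * c₂ j * wedgeCoord (b₁.prod b₂) x y (Sum.inl i) (Sum.inr j) ^ 2 := by
  have h : ∀ u u' v v', B₁ u u' * B₂ v v' = ∑ i, ∑ j, c₁ i * c₂ j *
      ((b₁.repr u i * b₁.repr u' i) * (b₂.repr v j * b₂.repr v' j)) := by
    intro u u' v v'
    rw [h₁, h₂, Finset.sum_mul_sum]
    exact Finset.sum_congr rfl fun i _ => Finset.sum_congr rfl fun j _ => by ring
  have h' : ∀ a a', (B₁ (x a).1 (x a').1 * B₂ (y a).2 (y a').2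
        + B₂ (x a).2 (x a').2 * B₁ (y a).1 (y a').1 - B₁ (x a).1 (y a').1 * B₂ (y a).2 (x a').2
        - B₂ (x a).2 (y a').2 * B₁ (y a).1 (x a').1) = ∑ i, ∑ j, c₁ i * c₂ j *
        ((b₁.repr (x a).1 i * b₂.repr (y a).2 j - b₂.repr (x a).2 j * b₁.repr (y a).1 i) *
        (b₁.repr (x a').1 i * b₂.repr (y a').2 j - b₂.repr (x a').2 j * b₁.repr (y a').1 i)) := by
    intro a a'
    rw [mul_comm (B₂ (x a).2 (x a').2), mul_comm (B₂ (x a).2 (y a').2), h, h, h, h]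
    simp only [← Finset.sum_add_distrib, ← Finset.sum_sub_distrib]
    exact Finset.sum_congr rfl fun i _ => Finset.sum_congr rfl fun j _ => by ring
  simp only [h']
  simp_rw [Finset.sum_comm (s := (Finset.univ : Finset κ)) (t := (Finset.univ : Finset ι₁)),
    Finset.sum_comm (s := (Finset.univ : Finset κ)) (t := (Finset.univ : Finset ι₂))]
  refine Finset.sum_congr rfl fun i _ => Finset.sum_congr rfl fun j _ => ?_
  simp only [← Finset.mul_sum, wedgeCoord, sq, ← Finset.sum_mul]
  simp

theorem posDef_prod [FiniteDimensional ℝ E₁] [FiniteDimensional ℝ E₂] {a b S : ℝ}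
    (ha : 0 < a) (hb : 0 < b) (hS : 0 < S)
    {B₁ : E₁ →L[ℝ] E₁ →L[ℝ] ℝ} {B₂ : E₂ →L[ℝ] E₂ →L[ℝ] ℝ}
    (hs₁ : ∀ u v, B₁ u v = B₁ v u) (hs₂ : ∀ u v, B₂ u v = B₂ v u)
    (hp₁ : ∀ v, v ≠ 0 → 0 < B₁ v v) (hp₂ : ∀ v, v ≠ 0 → 0 < B₂ v v)
    {T₁ : E₁ → E₁ → E₁ → E₁ → ℝ} {T₂ : E₂ → E₂ → E₂ → E₂ → ℝ}
    (hT₁ : CurvatureLike T₁) (hT₂ : CurvatureLike T₂)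
    (h₁ : PosDefOnBivectors fun u v w z =>
      S * a ^ 2 * (kulkarniNomizu B₁ B₁ u v w z / 2) + T₁ u v w z)
    (h₂ : PosDefOnBivectors fun u v w z =>
      S * b ^ 2 * (kulkarniNomizu B₂ B₂ u v w z / 2) + T₂ u v w z) :
    PosDefOnBivectors fun u v w z : E₁ × E₂ =>
      S * (kulkarniNomizu (prodForm a b B₁ B₂) (prodForm a b B₁ B₂) u v w z / 2)
        + (T₁ u.1 v.1 w.1 z.1 + T₂ u.2 v.2 w.2 z.2) := by
  obtain ⟨b₁, c₁, hc₁, hB₁⟩ := exists_diagonal_basis hs₁ hp₁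
  obtain ⟨b₂, c₂, hc₂, hB₂⟩ := exists_diagonal_basis hs₂ hp₂
  intro k x y hω
  have C₁ := ((curvatureLike_kulkarniNomizu B₁).const_mul (S * a ^ 2)).add hT₁
  have C₂ := ((curvatureLike_kulkarniNomizu B₂).const_mul (S * b ^ 2)).add hT₂
  have key : ∑ i, ∑ j, (S * (kulkarniNomizu (prodForm a b B₁ B₂) (prodForm a b B₁ B₂)
      (x i) (y i) (x j) (y j) / 2) + (T₁ (x i).1 (y i).1 (x j).1 (y j).1
        + T₂ (x i).2 (y i).2 (x j).2 (y j).2)) =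
      ∑ i, ∑ j, (S * a ^ 2 * (kulkarniNomizu B₁ B₁ (x i).1 (y i).1 (x j).1 (y j).1 / 2)
        + T₁ (x i).1 (y i).1 (x j).1 (y j).1) +
      ∑ i, ∑ j, (S * b ^ 2 * (kulkarniNomizu B₂ B₂ (x i).2 (y i).2 (x j).2 (y j).2 / 2)
        + T₂ (x i).2 (y i).2 (x j).2 (y j).2) +
      S * a * b * ∑ i, ∑ j,
        c₁ i * c₂ j * wedgeCoord (b₁.prod b₂) x y (Sum.inl i) (Sum.inr j) ^ 2 := by
    rw [← sum_mixed_eq b₁ b₂ c₁ c₂ hB₁ hB₂ x y]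
    simp only [Finset.mul_sum, ← Finset.sum_add_distrib]
    refine Finset.sum_congr rfl fun i _ => Finset.sum_congr rfl fun j _ => ?_
    simp only [kulkarniNomizu, prodForm_apply]
    ring
  rw [key]
  have n₁ := C₁.sum_nonneg h₁ (fun i => (x i).1) (fun i => (y i).1)
  have n₂ := C₂.sum_nonneg h₂ (fun i => (x i).2) (fun i => (y i).2)
  have hn : ∀ i j, 0 ≤ c₁ i * c₂ j * wedgeCoord (b₁.prod b₂) x y (Sum.inl i) (Sum.inr j) ^ 2 :=
    fun i j => by have := hc₁ i; have := hc₂ j; positivity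
  have n₃ : 0 ≤ S * a * b * ∑ i, ∑ j,
      c₁ i * c₂ j * wedgeCoord (b₁.prod b₂) x y (Sum.inl i) (Sum.inr j) ^ 2 :=
    mul_nonneg (by positivity) (Finset.sum_nonneg fun i _ => Finset.sum_nonneg fun j _ => hn i j)
  by_cases hω₁ : ∑ i, exteriorPower.ιMulti ℝ 2 ![(x i).1, (y i).1] = 0
  swap
  · have := h₁ k _ _ hω₁
    linarith
  by_cases hω₂ : ∑ i, exteriorPower.ιMulti ℝ 2 ![(x i).2, (y i).2] = 0
  swap
  · have := h₂ k _ _ hω₂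
    linarith
  suffices H : 0 < ∑ i, ∑ j,
      c₁ i * c₂ j * wedgeCoord (b₁.prod b₂) x y (Sum.inl i) (Sum.inr j) ^ 2 by
    have : 0 < S * a * b * ∑ i, ∑ j,
      c₁ i * c₂ j * wedgeCoord (b₁.prod b₂) x y (Sum.inl i) (Sum.inr j) ^ 2 := by positivity
    linarith
  rw [sum_ιMulti_eq_zero_iff b₁] at hω₁
  rw [sum_ιMulti_eq_zero_iff b₂] at hω₂
  by_contra hle
  apply hω
  rw [sum_ιMulti_eq_zero_iff (b₁.prod b₂)]
  have hz : ∀ i j, wedgeCoord (b₁.prod b₂) x y (Sum.inl i) (Sum.inr j) = 0 := by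
    intro i j
    by_contra hne
    apply hle
    refine Finset.sum_pos' (fun i _ => Finset.sum_nonneg fun j _ => hn i j)
      ⟨i, Finset.mem_univ i, Finset.sum_pos' (fun j _ => hn i j) ⟨j, Finset.mem_univ j, ?_⟩⟩
    have := hc₁ i; have := hc₂ j
    positivity
  ext i j
  rcases i with i | i <;> rcases j with j | j
  · simpa [wedgeCoord] using congrFun (congrFun hω₁ i) j
  · exact hz i j
  · rw [wedgeCoord_antisymm, hz]; simp
  · simpa [wedgeCoord] using congrFun (congrFun hω₂ i) j

end Product

section Charts

open Bundle

variable {E : Type*} [NormedAddCommGroup E] [NormedSpace ℝ E]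
  {H : Type*} [TopologicalSpace H] {I : ModelWithCorners ℝ E H}
  {M : Type*} [TopologicalSpace M] [ChartedSpace H M]

/-- A field of bilinear forms on `M`, written in the chart at `p`. -/
def formInChart (B : ∀ x : M, TangentSpace I x →L[ℝ] TangentSpace I x →L[ℝ] ℝ) (p : M) (y : E) :
    E →L[ℝ] E →L[ℝ] ℝ :=
  let A : E →L[ℝ] E := mfderiv 𝓘(ℝ, E) I (extChartAt I p).symm y
  let C : E →L[ℝ] E →L[ℝ] ℝ := B ((extChartAt I p).symm y)
  C.bilinearComp A A

theorem formInChart_apply (B : ∀ x : M, TangentSpace I x →L[ℝ] TangentSpace I x →L[ℝ] ℝ) (p : M)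
    (y u v : E) : formInChart B p y u v = B ((extChartAt I p).symm y)
      (mfderiv 𝓘(ℝ, E) I (extChartAt I p).symm y u)
      (mfderiv 𝓘(ℝ, E) I (extChartAt I p).symm y v) := rfl

variable [I.Boundaryless] [IsManifold I ∞ M]

theorem inCoordinates_eq_formInChart
    (B : ∀ x : M, TangentSpace I x →L[ℝ] TangentSpace I x →L[ℝ] ℝ) {p x : M}
    (hx : x ∈ (extChartAt I p).source) :
    ContinuousLinearMap.inCoordinates E (TangentSpace I) (E →L[ℝ] ℝ)
      (fun x : M => TangentSpace I x →L[ℝ] ℝ) p x p x (B x) =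
      formInChart B p (extChartAt I p x) := by
  have hx' : x ∈ (chartAt H p).source := by simpa using hx
  ext u v
  rw [formInChart_apply]
  have h1 := TangentBundle.symmL_trivializationAt (𝕜 := ℝ) (I := I) hx'
  rw [I.range_eq_univ, mfderivWithin_univ] at h1
  have := inCoordinates_apply_eq₂ (𝕜 := ℝ) (F₁ := E) (E₁ := TangentSpace I)
    (F₂ := E) (E₂ := TangentSpace I) (F₃ := ℝ) (E₃ := Bundle.Trivial M ℝ) (x₀ := p) (x := x)
    (ϕ := B x) (v := u) (w := v) (by simpa using hx') (by simpa using hx') (by simp)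
  refine this.trans ?_
  have h2 : ∀ w : E, (trivializationAt E (TangentSpace I) p).symm x w =
      (mfderiv 𝓘(ℝ, E) I (extChartAt I p).symm (extChartAt I p x) : E →L[ℝ] E) w := fun w =>
    ((Trivialization.symmL_apply _ (by simpa using hx') w).symm).trans
      (congrArg (fun L : E →L[ℝ] E => L w) h1)
  have h3 : ∀ x' : M, x' = x → ∀ a b : E,
      (B x' : E →L[ℝ] E →L[ℝ] ℝ) a b = (B x : E →L[ℝ] E →L[ℝ] ℝ) a b := by
    rintro x' rfl a b; rfl
  rw [h2, h2]
  refine Eq.trans ?_ (h3 _ ((extChartAt I p).left_inv hx) _ _).symm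
  simp

theorem contMDiffOn_section_iff (B : ∀ x : M, TangentSpace I x →L[ℝ] TangentSpace I x →L[ℝ] ℝ)
    (p : M) :
    ContMDiffOn I (I.prod 𝓘(ℝ, E →L[ℝ] E →L[ℝ] ℝ)) ∞
      (fun x => TotalSpace.mk' (E →L[ℝ] E →L[ℝ] ℝ) x (B x)) (extChartAt I p).source ↔
    ContDiffOn ℝ ∞ (formInChart B p) (extChartAt I p).target := by
  have hb : (trivializationAt (E →L[ℝ] E →L[ℝ] ℝ)
      (fun x : M => TangentSpace I x →L[ℝ] TangentSpace I x →L[ℝ] ℝ) p).baseSet =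
      (extChartAt I p).source := by
    rw [extChartAt_source]; simp
  have h := Trivialization.contMDiffOn_section_baseSet_iff (IB := I) (n := ∞)
    (F := E →L[ℝ] E →L[ℝ] ℝ)
    (e := trivializationAt (E →L[ℝ] E →L[ℝ] ℝ)
      (fun x : M => TangentSpace I x →L[ℝ] TangentSpace I x →L[ℝ] ℝ) p) (s := B)
  rw [hb] at h
  rw [h]
  have h1 : ∀ x ∈ (extChartAt I p).source, (trivializationAt (E →L[ℝ] E →L[ℝ] ℝ)
      (fun x : M => TangentSpace I x →L[ℝ] TangentSpace I x →L[ℝ] ℝ) p ⟨x, B x⟩).2 =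
      formInChart B p (extChartAt I p x) := fun x hx => inCoordinates_eq_formInChart B hx
  rw [contMDiffOn_congr h1, ← contMDiffOn_iff_contDiffOn]
  constructor
  · intro h2
    refine (h2.comp (contMDiffOn_extChartAt_symm p) (extChartAt I p).symm.mapsTo).congr ?_
    intro y hy
    rw [Function.comp_apply, (extChartAt I p).right_inv hy]
  · intro h2
    refine h2.comp ?_ (extChartAt I p).mapsTo
    rw [extChartAt_source]
    exact contMDiffOn_extChartAt


theorem mfderiv_extChartAt_symm_injective {p : M} {z : E} (hz : z ∈ (extChartAt I p).target) :
    Function.Injective (mfderiv 𝓘(ℝ, E) I (extChartAt I p).symm z : E →L[ℝ] E) := by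
  have h := isInvertible_mfderivWithin_extChartAt_symm (I := I) hz
  rw [I.range_eq_univ, mfderivWithin_univ] at h
  exact h.injective

theorem mdifferentiableAt_extChartAt_symm {p : M} {z : E} (hz : z ∈ (extChartAt I p).target) :
    MDifferentiableAt 𝓘(ℝ, E) I (extChartAt I p).symm z :=
  ((contMDiffOn_extChartAt_symm (n := ∞) p).contMDiffAt
    ((isOpen_extChartAt_target p).mem_nhds hz)).mdifferentiableAt (by simp)

theorem metricNear_metricInChart (g : Metric I M) {p : M} {z : E}
    (hz : z ∈ (extChartAt I p).target) : MetricNear (metricInChart g p) z := by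
  have ho : (extChartAt I p).target ∈ 𝓝 z := (isOpen_extChartAt_target p).mem_nhds hz
  have hs : ContDiffOn ℝ ∞ (metricInChart g p) (extChartAt I p).target :=
    (contMDiffOn_section_iff g.inner p).1 g.contMDiff.contMDiffOn
  refine ⟨?_, ?_, ?_⟩
  · filter_upwards [eventually_mem_nhds_iff.2 ho] with x hx using hs.contDiffAt hx
  · filter_upwards with x u v
    rw [metricInChart_apply, metricInChart_apply]
    exact g.symm _ _ _
  · filter_upwards [ho] with x hx v hv
    rw [metricInChart_apply]
    refine g.pos _ _ fun h0 => hv ?_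
    exact mfderiv_extChartAt_symm_injective hx (h0.trans (map_zero _).symm)

variable [FiniteDimensional ℝ E]

/-- A change of charts is an isometry of the metrics written in the charts. -/
theorem isometryNear_metricInChart (g : Metric I M) {p q : M}
    (hq : q ∈ (extChartAt I p).source) :
    IsometryNear (metricInChart g q) (metricInChart g p)
      (extChartAt I p ∘ (extChartAt I q).symm) (extChartAt I q q) := by
  have h0 : ∀ᶠ z in 𝓝 (extChartAt I q q),
      z ∈ (extChartAt I q).target ∧ (extChartAt I q).symm z ∈ (extChartAt I p).source := by
    refine Filter.Eventually.and (extChartAt_target_mem_nhds (I := I) q) ?_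
    refine (continuousAt_extChartAt_symm q).eventually ?_
    rw [extChartAt_to_inv]
    exact (isOpen_extChartAt_source p).mem_nhds hq
  have hφ : ∀ z, z ∈ (extChartAt I q).target ∧ (extChartAt I q).symm z ∈ (extChartAt I p).source →
      ContDiffAt ℝ ∞ (extChartAt I p ∘ (extChartAt I q).symm) z := by
    rintro z ⟨hz, hz'⟩
    rw [← contMDiffAt_iff_contDiffAt]
    refine ContMDiffAt.comp z (contMDiffAt_extChartAt' (by simpa using hz')) ?_
    exact (contMDiffOn_extChartAt_symm q).contMDiffAt ((isOpen_extChartAt_target q).mem_nhds hz)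
  have hd : ∀ᶠ z in 𝓝 (extChartAt I q q), ∀ v : E,
      (mfderiv 𝓘(ℝ, E) I (extChartAt I q).symm z : E →L[ℝ] E) v =
      (mfderiv 𝓘(ℝ, E) I (extChartAt I p).symm ((extChartAt I p ∘ (extChartAt I q).symm) z) :
        E →L[ℝ] E) (fderiv ℝ (extChartAt I p ∘ (extChartAt I q).symm) z v) := by
    filter_upwards [h0.eventually_nhds] with z hz v
    have h1 : (extChartAt I q).symm =ᶠ[𝓝 z]
        (extChartAt I p).symm ∘ (extChartAt I p ∘ (extChartAt I q).symm) := by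
      filter_upwards [hz] with x hx
      exact ((extChartAt I p).left_inv hx.2).symm
    have h2 : MDifferentiableAt 𝓘(ℝ, E) 𝓘(ℝ, E) (extChartAt I p ∘ (extChartAt I q).symm) z :=
      ((hφ z hz.self_of_nhds).differentiableAt (by simp)).mdifferentiableAt
    have h3 : MDifferentiableAt 𝓘(ℝ, E) I (extChartAt I p).symm
        ((extChartAt I p ∘ (extChartAt I q).symm) z) :=
      mdifferentiableAt_extChartAt_symm ((extChartAt I p).map_source hz.self_of_nhds.2)
    rw [h1.mfderiv_eq, mfderiv_comp z h3 h2, mfderiv_eq_fderiv]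
    rfl
  refine ⟨metricNear_metricInChart g (mem_extChartAt_target q), ?_, ?_, ?_, ?_⟩
  · filter_upwards [h0] with z hz
    exact metricNear_metricInChart g ((extChartAt I p).map_source hz.2)
  · filter_upwards [h0] with z hz using hφ z hz
  · filter_upwards [h0, hd] with z hz hdz
    have : Function.Injective (fderiv ℝ (extChartAt I p ∘ (extChartAt I q).symm)
        z).toLinearMap := by
      intro u v huv
      apply mfderiv_extChartAt_symm_injective hz.1
      rw [hdz, hdz]
      exact congrArg _ huv
    exact LinearMap.injective_iff_surjective.1 this
  · filter_upwards [h0, hd] with z hz hdz u v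
    have h3 : ∀ x' x : M, x' = x → ∀ a b : E,
        (g.inner x' : E →L[ℝ] E →L[ℝ] ℝ) a b = (g.inner x : E →L[ℝ] E →L[ℝ] ℝ) a b := by
      rintro x' x rfl a b; rfl
    rw [metricInChart_apply, metricInChart_apply]
    refine (h3 _ _ ((extChartAt I p).left_inv hz.2).symm _ _).trans ?_
    exact congrArg₂ (fun a b : E => (g.inner _ : E →L[ℝ] E →L[ℝ] ℝ) a b) (hdz u) (hdz v)

end Charts

section Combination

variable {E : Type*} [NormedAddCommGroup E] [NormedSpace ℝ E] [FiniteDimensional ℝ E]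
  {G G' : E → E →L[ℝ] E →L[ℝ] ℝ} {y : E}

theorem MetricNear.curvatureLike (h : MetricNear G y) : CurvatureLike (curvature4 G y) where
  left w z := ⟨fun u u' v => by
      rw [curvature4, show curvature G y (u + u') v z = _ from map_add (ricciEnd G y v z) u u',
        map_add, add_apply]
      rfl,
    fun c u v => by
      rw [curvature4, show curvature G y (c • u) v z = _ from map_smul (ricciEnd G y v z) c u,
        map_smul, smul_apply]
      rfl,
    fun u v => by rw [curvature4, curvature_antisymm]; simp [curvature4]⟩
  right u v := ⟨fun w w' z => by simp [curvature4], fun c w z => by simp [curvature4],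
    fun w z => h.curvature4_antisymm u v w z⟩

/-- The combination `a g² / 2 + b Scal g² / 2 + c R` of curvature tensors. -/
def curvatureComb (G : E → E →L[ℝ] E →L[ℝ] ℝ) (y : E) (c : ℝ × ℝ × ℝ) (u v w z : E) : ℝ :=
  (c.1 + c.2.1 * scal G y) * (kulkarniNomizu (G y) (G y) u v w z / 2)
    + c.2.2 * curvature4 G y u v w z

theorem riemTensor_eq (G : E → E →L[ℝ] E →L[ℝ] ℝ) (y : E) (t : ℝ) :
    riemTensor G y t = curvatureComb G y (0, 1, -2 * t) := by
  ext u v w z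
  simp only [riemTensor, curvatureComb]
  ring

theorem MetricNear.curvatureLike_comb (h : MetricNear G y) (c : ℝ × ℝ × ℝ) :
    CurvatureLike (curvatureComb G y c) :=
  ((curvatureLike_kulkarniNomizu (G y)).const_mul _).add (h.curvatureLike.const_mul _)

theorem MetricNear.continuousAt_curvature (h : MetricNear G y) (u v w : E) :
    ContinuousAt (fun x => curvature G x u v w) y := by
  have h1 : ContinuousAt (christoffel G) y := h.contDiffAt_christoffel.continuousAt
  have h2 : ContinuousAt (fderiv ℝ (christoffel G)) y :=
    (h.contDiffAt_christoffel.fderiv_right (m := ∞) (by simp)).continuousAt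
  simp only [curvature_apply]
  have e : ∀ a b : E, ContinuousAt (fun x => fderiv ℝ (christoffel G) x a b w) y := fun a b =>
    ((h2.clm_apply continuousAt_const).clm_apply continuousAt_const).clm_apply continuousAt_const
  have f : ∀ a b : E, ContinuousAt (fun x => christoffel G x a (christoffel G x b w)) y :=
    fun a b => (h1.clm_apply continuousAt_const).clm_apply
      ((h1.clm_apply continuousAt_const).clm_apply continuousAt_const)
  exact (((e u v).sub (e v u)).add (f u v)).sub (f v u)

theorem MetricNear.continuousAt_curvature4 (h : MetricNear G y) (u v w z : E) :
    ContinuousAt (fun x => curvature4 G x u v w z) y :=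
  (h.continuousAt.clm_apply (h.continuousAt_curvature u v z)).clm_apply continuousAt_const

theorem MetricNear.continuousAt_ricci (h : MetricNear G y) (v w : E) :
    ContinuousAt (fun x => ricci G x v w) y := by
  let b := Module.finBasis ℝ E
  have : (fun x => ricci G x v w) = fun x => ∑ i, b.repr (curvature G x (b i) v w) i := by
    ext x
    rw [ricci_apply, LinearMap.trace_eq_matrix_trace ℝ b, Matrix.trace]
    simp [LinearMap.toMatrix_apply, ricciEnd]
  rw [this]
  refine tendsto_finsetSum _ fun i _ => ?_
  have hc : Continuous (b.coord i) := LinearMap.continuous_of_finiteDimensional _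
  exact hc.continuousAt.comp (h.continuousAt_curvature (b i) v w)

theorem MetricNear.continuousAt_scal (h : MetricNear G y) : ContinuousAt (scal G) y := by
  let b := Module.finBasis ℝ E
  have : scal G = fun x => ∑ i, b.coord i ((G x).inverse
      (∑ j, ricci G x (b i) (b j) • LinearMap.toContinuousLinearMap (b.coord j))) := by
    ext x
    rw [scal_eq, LinearMap.trace_eq_matrix_trace ℝ b, Matrix.trace]
    refine Finset.sum_congr rfl fun i _ => ?_
    rw [Matrix.diag_apply, LinearMap.toMatrix_apply, ← b.coord_apply]
    congr 1
    change (G x).inverse _ = _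
    congr 1
    ext v
    have hv : ricci G x (b i) v = ∑ j, ricci G x (b i) (b j) * b.repr v j := by
      have h1 := congrArg (ricci G x (b i)) (b.sum_repr v)
      rw [map_sum] at h1
      rw [← h1]
      exact Finset.sum_congr rfl fun j _ => by rw [map_smul, smul_eq_mul, mul_comm]
    simpa using hv
  rw [this]
  refine tendsto_finsetSum _ fun i _ => ?_
  have hc : Continuous (b.coord i) := LinearMap.continuous_of_finiteDimensional _
  have hi : ContinuousAt (fun x => (G x).inverse) y := by
    obtain ⟨e, he⟩ := h.isInvertible
    have := (contDiffAt_map_inverse (𝕜 := ℝ) (n := 0) e).continuousAt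
    rw [he] at this
    exact this.comp h.continuousAt
  refine hc.continuousAt.comp (hi.clm_apply ?_)
  exact tendsto_finsetSum _ fun j _ => (h.continuousAt_ricci (b i) (b j)).smul continuousAt_const

theorem MetricNear.continuousAt_comb (h : MetricNear G y) (c : ℝ × ℝ × ℝ) (u v w z : E) :
    ContinuousAt (fun x : (ℝ × ℝ × ℝ) × E => curvatureComb G x.2 x.1 u v w z) (c, y) := by
  have hs : ContinuousAt (Prod.snd : (ℝ × ℝ × ℝ) × E → E) (c, y) := continuousAt_snd
  have hG : ∀ a b : E, ContinuousAt (fun x : (ℝ × ℝ × ℝ) × E => G x.2 a b) (c, y) := fun a b =>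
    ContinuousAt.comp (g := fun x => G x a b) (f := Prod.snd)
      ((h.continuousAt.clm_apply continuousAt_const).clm_apply continuousAt_const) hs
  have hS : ContinuousAt (fun x : (ℝ × ℝ × ℝ) × E => scal G x.2) (c, y) :=
    ContinuousAt.comp (g := scal G) (f := Prod.snd) h.continuousAt_scal hs
  have hR : ContinuousAt (fun x : (ℝ × ℝ × ℝ) × E => curvature4 G x.2 u v w z) (c, y) :=
    ContinuousAt.comp (g := fun x => curvature4 G x u v w z) (f := Prod.snd)
      (h.continuousAt_curvature4 u v w z) hs
  unfold curvatureComb kulkarniNomizu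
  have h1 : ContinuousAt (fun x : (ℝ × ℝ × ℝ) × E => x.1.1) (c, y) := by fun_prop
  have h2 : ContinuousAt (fun x : (ℝ × ℝ × ℝ) × E => x.1.2.1) (c, y) := by fun_prop
  have h3 : ContinuousAt (fun x : (ℝ × ℝ × ℝ) × E => x.1.2.2) (c, y) := by fun_prop
  exact ((h1.add (h2.mul hS)).mul ((((((hG u w).mul (hG v z)).add ((hG v z).mul (hG u w))).sub
    ((hG u z).mul (hG v w))).sub ((hG v w).mul (hG u z))).div_const 2)).add (h3.mul hR)

theorem IsometryNear.comb_apply {φ : E → E} (h : IsometryNear G' G φ y) (c : ℝ × ℝ × ℝ)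
    (u v w z : E) : curvatureComb G' y c u v w z = curvatureComb G (φ y) c (fderiv ℝ φ y u)
      (fderiv ℝ φ y v) (fderiv ℝ φ y w) (fderiv ℝ φ y z) := by
  simp only [curvatureComb, kulkarniNomizu, h.scal_eq, h.curvature4_apply, h.pullback.self_of_nhds]

theorem PosDefOnBivectors.comp_equiv {T : E → E → E → E → ℝ} (hT : PosDefOnBivectors T)
    (e : E ≃ₗ[ℝ] E) : PosDefOnBivectors fun u v w z => T (e u) (e v) (e w) (e z) := by
  intro k x y hω
  refine hT k (fun a => e (x a)) (fun a => e (y a)) ?_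
  let b := Module.finBasis ℝ E
  rw [ne_eq, sum_ιMulti_eq_zero_iff (b.map e)]
  rw [ne_eq, sum_ιMulti_eq_zero_iff b] at hω
  have : wedgeCoord (b.map e) (fun a => e (x a)) (fun a => e (y a)) = wedgeCoord b x y := by
    ext i j
    simp [wedgeCoord]
  rwa [this]

theorem IsometryNear.posDef_comb {φ : E → E} (h : IsometryNear G' G φ y) {c : ℝ × ℝ × ℝ}
    (hc : PosDefOnBivectors (curvatureComb G (φ y) c)) :
    PosDefOnBivectors (curvatureComb G' y c) := by
  obtain ⟨e, he⟩ := h.exists_equiv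
  have : curvatureComb G' y c =
      fun u v w z => curvatureComb G (φ y) c (e u) (e v) (e w) (e z) := by
    ext u v w z
    simp only [h.comb_apply, he]
  rw [this]
  exact hc.comp_equiv e

end Combination

section Manifold

variable {E : Type*} [NormedAddCommGroup E] [NormedSpace ℝ E] [FiniteDimensional ℝ E]
  {H : Type*} [TopologicalSpace H] {I : ModelWithCorners ℝ E H}
  {M : Type*} [TopologicalSpace M] [ChartedSpace H M] [IsManifold I ∞ M]

/-- Positivity of `a g² / 2 + b Scal g² / 2 + c R` on all of `M`. -/
def CombPos (g : Metric I M) (c : ℝ × ℝ × ℝ) : Prop :=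
  ∀ p : M, PosDefOnBivectors (curvatureComb (metricInChart g p) (extChartAt I p p) c)

theorem riemTensorPos_iff (g : Metric I M) (t : ℝ) :
    RiemTensorPos g t ↔ CombPos g (0, 1, -2 * t) := by
  simp only [RiemTensorPos, riemTensorAt, riemTensor_eq, CombPos]

variable [I.Boundaryless]

theorem scalAt_eq (g : Metric I M) {p q : M} (hq : q ∈ (extChartAt I p).source) :
    scalAt g q = scal (metricInChart g p) (extChartAt I p q) := by
  rw [scalAt, (isometryNear_metricInChart g hq).scal_eq, Function.comp_apply, extChartAt_to_inv]

theorem continuous_scalAt (g : Metric I M) : Continuous (scalAt g) := by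
  rw [continuous_iff_continuousAt]
  intro p
  have h1 : ContinuousAt (fun q => scal (metricInChart g p) (extChartAt I p q)) p :=
    ContinuousAt.comp (f := extChartAt I p)
      (metricNear_metricInChart g (mem_extChartAt_target p)).continuousAt_scal
      (continuousAt_extChartAt p)
  refine h1.congr ?_
  filter_upwards [extChartAt_source_mem_nhds (I := I) p] with q hq using (scalAt_eq g hq).symm

theorem combPos_metric (g : Metric I M) {m : ℝ} (hm : 0 < m) : CombPos g (m, 0, 0) := by
  intro p k x y hω
  have h := metricNear_metricInChart g (mem_extChartAt_target (I := I) p)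
  have := posDef_kulkarniNomizu h.symm.self_of_nhds h.pos.self_of_nhds k x y hω
  simp only [curvatureComb, zero_mul, add_zero, ← Finset.mul_sum]
  exact mul_pos hm this

/-- On a compact manifold positivity is an open condition on the coefficients. -/
theorem CombPos.eventually [CompactSpace M] {g : Metric I M} {c : ℝ × ℝ × ℝ} (h : CombPos g c) :
    ∀ᶠ c' in 𝓝 c, CombPos g c' := by
  have key : ∀ᶠ c' in 𝓝 c, ∀ p ∈ (Set.univ : Set M),
      PosDefOnBivectors (curvatureComb (metricInChart g p) (extChartAt I p p) c') := by
    refine isCompact_univ.eventually_forall_of_forall_eventually fun p _ => ?_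
    have hm := metricNear_metricInChart g (mem_extChartAt_target (I := I) p)
    have hsrc : ∀ᶠ x : (ℝ × ℝ × ℝ) × M in 𝓝 (c, p), x.2 ∈ (extChartAt I p).source :=
      continuousAt_snd.eventually (extChartAt_source_mem_nhds (I := I) p)
    have hchart : ContinuousAt (fun x : (ℝ × ℝ × ℝ) × M => extChartAt I p x.2) (c, p) :=
      ContinuousAt.comp (f := Prod.snd) (continuousAt_extChartAt (I := I) p) continuousAt_snd
    have hev : ∀ᶠ x : (ℝ × ℝ × ℝ) × M in 𝓝 (c, p),
        PosDefOnBivectors (curvatureComb (metricInChart g p) (extChartAt I p x.2) x.1) := by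
      refine PosDefOnBivectors.eventually (Module.finBasis ℝ E)
        (T := fun x : (ℝ × ℝ × ℝ) × M =>
          curvatureComb (metricInChart g p) (extChartAt I p x.2) x.1) ?_ ?_ (h p)
      · filter_upwards [hchart.eventually hm.eventually] with x hx using hx.curvatureLike_comb _
      · intro i j k l
        exact ContinuousAt.comp (f := fun x : (ℝ × ℝ × ℝ) × M => (x.1, extChartAt I p x.2))
          (hm.continuousAt_comb c _ _ _ _) (continuousAt_fst.prodMk hchart)
    filter_upwards [hev, hsrc] with x hx hx'
    refine (isometryNear_metricInChart g hx').posDef_comb ?_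
    rwa [Function.comp_apply, extChartAt_to_inv]
  filter_upwards [key] with c' hc' p using hc' p (Set.mem_univ p)

end Manifold

section FormBounds

variable {E : Type*} [NormedAddCommGroup E] [NormedSpace ℝ E] [FiniteDimensional ℝ E]

theorem isVonNBounded_of_pos (B : E →L[ℝ] E →L[ℝ] ℝ) (hB : ∀ v, v ≠ 0 → 0 < B v v) :
    Bornology.IsVonNBounded ℝ {v : E | B v v < 1} := by
  have : ProperSpace E := FiniteDimensional.proper ℝ E
  obtain ⟨c, hc, hcB⟩ := (isCompact_sphere (0 : E) 1).exists_forall_le' (f := fun v => B v v)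
    (a := 0) (B.continuous.clm_apply continuous_id).continuousOn
    (fun v hv => hB v (by rintro rfl; simp at hv))
  rw [NormedSpace.isVonNBounded_iff, isBounded_iff_forall_norm_le]
  refine ⟨Real.sqrt (c⁻¹), fun v hv => Real.le_sqrt_of_sq_le ?_⟩
  by_cases h0 : v = 0
  · simp [h0, hc.le]
  have hn : ‖v‖ ≠ 0 := norm_ne_zero_iff.2 h0
  have h1 := hcB (‖v‖⁻¹ • v) (by simp [norm_smul, hn])
  simp only [map_smul, smul_apply, smul_eq_mul] at h1
  have h2 : c * ‖v‖ ^ 2 ≤ B v v := by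
    have := mul_le_mul_of_nonneg_right h1 (sq_nonneg ‖v‖)
    calc _ ≤ _ := this
      _ = _ := by field_simp
  have h3 : c * ‖v‖ ^ 2 ≤ 1 := h2.trans (le_of_lt hv)
  rw [← one_div, le_div_iff₀ hc]
  linarith

variable (E) in
theorem exists_posForm : ∃ B : E →L[ℝ] E →L[ℝ] ℝ,
    (∀ u v, B u v = B v u) ∧ ∀ v, v ≠ 0 → 0 < B v v := by
  let e := (toEuclidean : E ≃L[ℝ] EuclideanSpace ℝ (Fin (Module.finrank ℝ E)))
  let L : E →L[ℝ] EuclideanSpace ℝ (Fin (Module.finrank ℝ E)) := e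
  refine ⟨(innerSL ℝ).bilinearComp L L, fun u v => ?_, fun v hv => ?_⟩
  · simp [real_inner_comm]
  · simp only [ContinuousLinearMap.bilinearComp_apply]
    have h1 : L v ≠ 0 := by simpa [L] using hv
    exact real_inner_self_pos.2 h1

end FormBounds

section Existence

open Bundle

variable {E : Type*} [NormedAddCommGroup E] [NormedSpace ℝ E] [FiniteDimensional ℝ E]
  {H : Type*} [TopologicalSpace H] (I : ModelWithCorners ℝ E H) [I.Boundaryless]
  (M : Type*) [TopologicalSpace M] [ChartedSpace H M] [IsManifold I ∞ M]

/-- A compact manifold has a Riemannian metric. -/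
theorem nonempty_metric [T2Space M] [CompactSpace M] : Nonempty (Metric I M) := by
  obtain ⟨B₀, hs, hp⟩ := exists_posForm E
  obtain ⟨s, hst⟩ := exists_contMDiffSection_forall_mem_convex_of_local (I := I) (n := ⊤)
    (F_fiber := E →L[ℝ] E →L[ℝ] ℝ)
    (V := fun x : M => TangentSpace I x →L[ℝ] TangentSpace I x →L[ℝ] ℝ)
    (t := fun x => {B | (∀ u v, B u v = B v u) ∧ ∀ v, v ≠ 0 → 0 < B v v})
    (fun x => by
      intro B hB C hC a b ha hb hab
      refine ⟨fun u v => ?_, fun v hv => ?_⟩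
      · simp [hB.1 u v, hC.1 u v]
      · have h1 := hB.2 v hv
        have h2 := hC.2 v hv
        have h3 : 0 < a * B v v + b * C v v := by
          rcases ha.eq_or_lt with h | h
          · have : b = 1 := by linarith
            simp [← h, this, h2]
          · have := mul_pos h h1
            have := mul_nonneg hb h2.le
            linarith
        simpa using h3)
    (fun p => by
      let A : ∀ x : M, E →L[ℝ] E := fun x => mfderiv I 𝓘(ℝ, E) (extChartAt I p) x
      let C : ∀ x : M, E →L[ℝ] E →L[ℝ] ℝ := fun x => B₀.bilinearComp (A x) (A x)
      refine ⟨_, extChartAt_source_mem_nhds (I := I) p, C, ?_, ?_⟩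
      · refine (contMDiffOn_section_iff _ p).2 ((contDiffOn_const (c := B₀)).congr ?_)
        intro y hy
        ext u v
        have h1 := mfderiv_extChartAt_comp_mfderivWithin_extChartAt_symm (I := I) hy
        rw [I.range_eq_univ, mfderivWithin_univ] at h1
        have h2 : ∀ w : E, A ((extChartAt I p).symm y)
            (mfderiv 𝓘(ℝ, E) I (extChartAt I p).symm y w) = w := fun w =>
          congrArg (fun L : E →L[ℝ] E => L w) h1
        exact congrArg₂ (fun a b => B₀ a b) (h2 u) (h2 v)
      · intro x hx
        refine ⟨fun u v => hs _ _, fun v hv => hp _ fun h0 => hv ?_⟩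
        have h1 := (isInvertible_mfderiv_extChartAt (I := I) hx).injective
        exact h1 (h0.trans (map_zero _).symm))
  exact ⟨⟨fun x => s x, fun x => (hst x).1, fun x => (hst x).2,
    fun x => isVonNBounded_of_pos (E := E) (s x) (hst x).2, s.contMDiff⟩⟩

end Existence

section ProductMetric

variable {E₁ : Type*} [NormedAddCommGroup E₁] [NormedSpace ℝ E₁]
  {H₁ : Type*} [TopologicalSpace H₁] {I₁ : ModelWithCorners ℝ E₁ H₁} [I₁.Boundaryless]
  {E₂ : Type*} [NormedAddCommGroup E₂] [NormedSpace ℝ E₂]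
  {H₂ : Type*} [TopologicalSpace H₂] {I₂ : ModelWithCorners ℝ E₂ H₂} [I₂.Boundaryless]
  {M₁ : Type*} [TopologicalSpace M₁] [ChartedSpace H₁ M₁] [IsManifold I₁ ∞ M₁]
  {M₂ : Type*} [TopologicalSpace M₂] [ChartedSpace H₂ M₂] [IsManifold I₂ ∞ M₂]

theorem mfderiv_extChartAt_symm_prod {p : M₁ × M₂} {y : E₁ × E₂}
    (hy : y ∈ (extChartAt (I₁.prod I₂) p).target) (v : E₁ × E₂) :
    (mfderiv 𝓘(ℝ, E₁ × E₂) (I₁.prod I₂) (extChartAt (I₁.prod I₂) p).symm y :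
      E₁ × E₂ →L[ℝ] E₁ × E₂) v =
    ((mfderiv 𝓘(ℝ, E₁) I₁ (extChartAt I₁ p.1).symm y.1 : E₁ →L[ℝ] E₁) v.1,
      (mfderiv 𝓘(ℝ, E₂) I₂ (extChartAt I₂ p.2).symm y.2 : E₂ →L[ℝ] E₂) v.2) := by
  rw [extChartAt_prod] at hy ⊢
  have h₁ := mdifferentiableAt_extChartAt_symm (I := I₁) hy.1
  have h₂ := mdifferentiableAt_extChartAt_symm (I := I₂) hy.2
  have f₁ : MDifferentiableAt 𝓘(ℝ, E₁ × E₂) 𝓘(ℝ, E₁) (Prod.fst : E₁ × E₂ → E₁) y :=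
    differentiableAt_fst.mdifferentiableAt
  have f₂ : MDifferentiableAt 𝓘(ℝ, E₁ × E₂) 𝓘(ℝ, E₂) (Prod.snd : E₁ × E₂ → E₂) y :=
    differentiableAt_snd.mdifferentiableAt
  have h := mfderiv_prodMk (h₁.comp y f₁) (h₂.comp y f₂)
  rw [mfderiv_comp y h₁ f₁, mfderiv_comp y h₂ f₂, mfderiv_eq_fderiv, mfderiv_eq_fderiv,
    fderiv_fst, fderiv_snd] at h
  exact congrArg (fun L : E₁ × E₂ →L[ℝ] E₁ × E₂ => L v) h

/-- The form `a g₁ + b g₂` on a product of manifolds. -/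
def prodInner (a b : ℝ) (g₁ : Metric I₁ M₁) (g₂ : Metric I₂ M₂) (p : M₁ × M₂) :
    TangentSpace (I₁.prod I₂) p →L[ℝ] TangentSpace (I₁.prod I₂) p →L[ℝ] ℝ :=
  let B : E₁ × E₂ →L[ℝ] E₁ × E₂ →L[ℝ] ℝ := prodForm a b (E₁ := E₁) (E₂ := E₂)
    (g₁.inner p.1) (g₂.inner p.2)
  B

theorem formInChart_prodInner (a b : ℝ) (g₁ : Metric I₁ M₁) (g₂ : Metric I₂ M₂) {p : M₁ × M₂}
    {y : E₁ × E₂} (hy : y ∈ (extChartAt (I₁.prod I₂) p).target) :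
    formInChart (prodInner a b g₁ g₂) p y =
      prodMetric a b (metricInChart g₁ p.1) (metricInChart g₂ p.2) y := by
  apply ContinuousLinearMap.ext; intro u
  apply ContinuousLinearMap.ext; intro v
  rw [formInChart_apply, prodMetric, prodForm_apply, metricInChart_apply, metricInChart_apply]
  have h := congrArg₂ (fun u v : E₁ × E₂ =>
    (prodInner a b g₁ g₂ ((extChartAt (I₁.prod I₂) p).symm y) :
      E₁ × E₂ →L[ℝ] E₁ × E₂ →L[ℝ] ℝ) u v)
    (mfderiv_extChartAt_symm_prod hy u) (mfderiv_extChartAt_symm_prod hy v)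
  refine h.trans ?_
  refine (prodForm_apply _ _ _ _ _ _).trans ?_
  rw [extChartAt_prod]
  rfl

variable [FiniteDimensional ℝ E₁] [FiniteDimensional ℝ E₂]

/-- The Riemannian metric `a g₁ + b g₂` on a product of manifolds. -/
def prodRiemannian {a b : ℝ} (ha : 0 < a) (hb : 0 < b) (g₁ : Metric I₁ M₁) (g₂ : Metric I₂ M₂) :
    Metric (I₁.prod I₂) (M₁ × M₂) where
  inner := prodInner a b g₁ g₂
  symm p u v := by
    refine (prodForm_apply _ _ _ _ _ _).trans (Eq.trans ?_ (prodForm_apply _ _ _ _ _ _).symm)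
    exact congrArg₂ (fun s t => a * s + b * t) (g₁.symm p.1 _ _) (g₂.symm p.2 _ _)
  pos p v hv := prodForm_pos (E₁ := E₁) (E₂ := E₂) ha hb (g₁.pos p.1) (g₂.pos p.2) v hv
  isVonNBounded p := isVonNBounded_of_pos (E := E₁ × E₂) _
    fun v hv => prodForm_pos (E₁ := E₁) (E₂ := E₂) ha hb (g₁.pos p.1) (g₂.pos p.2) v hv
  contMDiff p := by
    refine ((contMDiffOn_section_iff (prodInner a b g₁ g₂) p).2 fun y hy => ?_).contMDiffAt
      (extChartAt_source_mem_nhds (I := I₁.prod I₂) p)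
    have hy' := hy
    rw [extChartAt_prod] at hy'
    have h := ((metricNear_metricInChart g₁ hy'.1).prod (metricNear_metricInChart g₂ hy'.2)
      ha hb).contDiffAt.self_of_nhds
    exact h.contDiffWithinAt.congr (fun z hz => formInChart_prodInner a b g₁ g₂ hz)
      (formInChart_prodInner a b g₁ g₂ hy)

variable {a b : ℝ} (ha : 0 < a) (hb : 0 < b) (g₁ : Metric I₁ M₁) (g₂ : Metric I₂ M₂)

theorem metricInChart_prodRiemannian (p : M₁ × M₂) :
    metricInChart (prodRiemannian ha hb g₁ g₂) p =ᶠ[𝓝 (extChartAt (I₁.prod I₂) p p)]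
      prodMetric a b (metricInChart g₁ p.1) (metricInChart g₂ p.2) := by
  filter_upwards [extChartAt_target_mem_nhds (I := I₁.prod I₂) p] with y hy
  exact formInChart_prodInner a b g₁ g₂ hy

theorem scalAt_prodRiemannian (p : M₁ × M₂) :
    scalAt (prodRiemannian ha hb g₁ g₂) p = a⁻¹ * scalAt g₁ p.1 + b⁻¹ * scalAt g₂ p.2 := by
  rw [scalAt, scal_congr (metricInChart_prodRiemannian ha hb g₁ g₂ p), extChartAt_prod]
  exact scal_prodMetric (y := (extChartAt I₁ p.1 p.1, extChartAt I₂ p.2 p.2))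
    (metricNear_metricInChart g₁ (mem_extChartAt_target p.1))
    (metricNear_metricInChart g₂ (mem_extChartAt_target p.2)) ha hb

/-- The Kulkarni-Nomizu square of the metric at `p`, divided by `2`. -/
def metricSquareAt {E H M : Type*} [NormedAddCommGroup E] [NormedSpace ℝ E]
    [TopologicalSpace H] {I : ModelWithCorners ℝ E H} [TopologicalSpace M] [ChartedSpace H M]
    [IsManifold I ∞ M] (g : Metric I M) (p : M) (u v w z : E) : ℝ :=
  kulkarniNomizu (metricInChart g p (extChartAt I p p)) (metricInChart g p (extChartAt I p p))
    u v w z / 2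

/-- The curvature tensor at `p`. -/
def curvatureAt {E H M : Type*} [NormedAddCommGroup E] [NormedSpace ℝ E]
    [TopologicalSpace H] {I : ModelWithCorners ℝ E H} [TopologicalSpace M] [ChartedSpace H M]
    [IsManifold I ∞ M] (g : Metric I M) (p : M) (u v w z : E) : ℝ :=
  curvature4 (metricInChart g p) (extChartAt I p p) u v w z

theorem posDef_metricSquareAt {E H M : Type*} [NormedAddCommGroup E] [NormedSpace ℝ E]
    [FiniteDimensional ℝ E] [TopologicalSpace H] {I : ModelWithCorners ℝ E H} [I.Boundaryless]
    [TopologicalSpace M] [ChartedSpace H M] [IsManifold I ∞ M] (g : Metric I M) (p : M) :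
    PosDefOnBivectors (metricSquareAt g p) :=
  have h := metricNear_metricInChart g (mem_extChartAt_target (I := I) p)
  posDef_kulkarniNomizu h.symm.self_of_nhds h.pos.self_of_nhds

theorem riemTensorPos_prodRiemannian {t : ℝ}
    (hS : ∀ p q, 0 < a⁻¹ * scalAt g₁ p + b⁻¹ * scalAt g₂ q)
    (h₁ : ∀ p q, PosDefOnBivectors fun u v w z =>
      (a⁻¹ * scalAt g₁ p + b⁻¹ * scalAt g₂ q) * a ^ 2 * metricSquareAt g₁ p u v w z
        + (-2 * t * a) * curvatureAt g₁ p u v w z)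
    (h₂ : ∀ p q, PosDefOnBivectors fun u v w z =>
      (a⁻¹ * scalAt g₁ p + b⁻¹ * scalAt g₂ q) * b ^ 2 * metricSquareAt g₂ q u v w z
        + (-2 * t * b) * curvatureAt g₂ q u v w z) :
    RiemTensorPos (prodRiemannian ha hb g₁ g₂) t := by
  rintro ⟨p, q⟩
  have m₁ := metricNear_metricInChart g₁ (mem_extChartAt_target (I := I₁) p)
  have m₂ := metricNear_metricInChart g₂ (mem_extChartAt_target (I := I₂) q)
  have key := posDef_prod ha hb (hS p q) m₁.symm.self_of_nhds m₂.symm.self_of_nhds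
    m₁.pos.self_of_nhds m₂.pos.self_of_nhds (m₁.curvatureLike.const_mul (-2 * t * a))
    (m₂.curvatureLike.const_mul (-2 * t * b)) (h₁ p q) (h₂ p q)
  have heq := metricInChart_prodRiemannian ha hb g₁ g₂ (p, q)
  have hc := curvature4_prodMetric (y := (extChartAt I₁ p p, extChartAt I₂ q q)) m₁ m₂ ha hb
  have : riemTensorAt (prodRiemannian ha hb g₁ g₂) t (p, q) = fun u v w z =>
      (a⁻¹ * scalAt g₁ p + b⁻¹ * scalAt g₂ q) *
        (kulkarniNomizu (prodForm a b (metricInChart g₁ p (extChartAt I₁ p p))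
          (metricInChart g₂ q (extChartAt I₂ q q)))
          (prodForm a b (metricInChart g₁ p (extChartAt I₁ p p))
          (metricInChart g₂ q (extChartAt I₂ q q))) u v w z / 2) +
        (-2 * t * a * curvature4 (metricInChart g₁ p) (extChartAt I₁ p p) u.1 v.1 w.1 z.1 +
         -2 * t * b * curvature4 (metricInChart g₂ q) (extChartAt I₂ q q) u.2 v.2 w.2 z.2) := by
    funext u v w z
    rw [riemTensorAt, riemTensor, ← scalAt, scalAt_prodRiemannian, curvature4_congr heq,
      heq.self_of_nhds, extChartAt_prod]
    have := hc u v w z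
    simp only [PartialEquiv.prod_coe] at this ⊢
    rw [this, prodMetric]
    ring
  rw [this]
  exact key

end ProductMetric

section Scaling

theorem PosDefOnBivectors.mul_add {E : Type*} [NormedAddCommGroup E] [NormedSpace ℝ E]
    {T T' T'' : E → E → E → E → ℝ} (hT : PosDefOnBivectors T) (hT' : PosDefOnBivectors T')
    {k r : ℝ} (hk : 0 < k) (hr : 0 ≤ r)
    (h : ∀ u v w z, T'' u v w z = k * (T u v w z + r * T' u v w z)) :
    PosDefOnBivectors T'' := by
  intro n x y hω
  have h1 := hT n x y hω
  have h2 := mul_nonneg hr (hT' n x y hω).le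
  simp only [h, ← Finset.mul_sum, Finset.sum_add_distrib]
  exact mul_pos hk (by linarith)

variable {E₁ : Type*} [NormedAddCommGroup E₁] [NormedSpace ℝ E₁] [FiniteDimensional ℝ E₁]
  {H₁ : Type*} [TopologicalSpace H₁] {I₁ : ModelWithCorners ℝ E₁ H₁} [I₁.Boundaryless]
  {E₂ : Type*} [NormedAddCommGroup E₂] [NormedSpace ℝ E₂] [FiniteDimensional ℝ E₂]
  {H₂ : Type*} [TopologicalSpace H₂] {I₂ : ModelWithCorners ℝ E₂ H₂} [I₂.Boundaryless]
  {M₁ : Type*} [TopologicalSpace M₁] [ChartedSpace H₁ M₁] [IsManifold I₁ ∞ M₁] [CompactSpace M₁]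
  {M₂ : Type*} [TopologicalSpace M₂] [ChartedSpace H₂ M₂] [IsManifold I₂ ∞ M₂] [CompactSpace M₂]

theorem exists_scaling (g₁ : Metric I₁ M₁) (g₂ : Metric I₂ M₂) {t : ℝ}
    (hs : ∀ p, 0 < scalAt g₁ p) (ht : RiemTensorPos g₁ t) :
    ∃ ε : ℝ, 0 < ε ∧ (∀ p q, 0 < ε⁻¹ * scalAt g₁ p + scalAt g₂ q) ∧
      (∀ p q, PosDefOnBivectors fun u v w z =>
        (ε⁻¹ * scalAt g₁ p + scalAt g₂ q) * ε ^ 2 * metricSquareAt g₁ p u v w z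
          + (-2 * t * ε) * curvatureAt g₁ p u v w z) ∧
      ∀ p q, PosDefOnBivectors fun u v w z =>
        (ε⁻¹ * scalAt g₁ p + scalAt g₂ q) * metricSquareAt g₂ q u v w z
          + (-2 * t) * curvatureAt g₂ q u v w z := by
  obtain ⟨m, hm, hm1⟩ := isCompact_univ.exists_forall_le' (f := scalAt g₁) (a := 0)
    (continuous_scalAt g₁).continuousOn (fun p _ => hs p)
  obtain ⟨C, hC⟩ := isCompact_univ.exists_bound_of_continuousOn (f := scalAt g₂)
    (continuous_scalAt g₂).continuousOn
  have hC' : ∀ q, 0 ≤ scalAt g₂ q + C := fun q => by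
    have := neg_le_of_abs_le (hC q (Set.mem_univ q)); linarith
  have e₁ : ∀ᶠ ε : ℝ in 𝓝 0, CombPos g₁ (-(C * ε), 1, -2 * t) := by
    have hc : ContinuousAt (fun ε : ℝ => ((-(C * ε), 1, -2 * t) : ℝ × ℝ × ℝ)) 0 := by fun_prop
    refine hc.eventually (CombPos.eventually ?_)
    simpa using (riemTensorPos_iff g₁ t).1 ht
  have e₂ : ∀ᶠ ε : ℝ in 𝓝 0, CombPos g₂ (m, ε, -2 * t * ε) := by
    have hc : ContinuousAt (fun ε : ℝ => ((m, ε, -2 * t * ε) : ℝ × ℝ × ℝ)) 0 := by fun_prop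
    refine hc.eventually (CombPos.eventually ?_)
    simpa using combPos_metric g₂ hm
  have e₃ : ∀ᶠ ε : ℝ in 𝓝 0, 0 < m - C * ε := by
    have hc : ContinuousAt (fun ε : ℝ => m - C * ε) 0 := by fun_prop
    exact hc.eventually (lt_mem_nhds (by simpa using hm))
  obtain ⟨ε, ⟨h₁, h₂, h₃⟩, hε⟩ := (((e₁.and (e₂.and e₃)).filter_mono nhdsWithin_le_nhds).and
    (self_mem_nhdsWithin (s := Set.Ioi (0 : ℝ)) (a := 0))).exists
  have hε : 0 < ε := hε
  refine ⟨ε, hε, fun p q => ?_, fun p q => ?_, fun p q => ?_⟩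
  · have h4 := hm1 p (Set.mem_univ p)
    have h5 := mul_nonneg hε.le (hC' q)
    have h6 : ε⁻¹ * scalAt g₁ p + scalAt g₂ q = ε⁻¹ * (scalAt g₁ p + ε * scalAt g₂ q) := by
      field_simp
    rw [h6]
    refine mul_pos (inv_pos.2 hε) ?_
    linarith
  · refine (h₁ p).mul_add (posDef_metricSquareAt g₁ p) hε (mul_nonneg hε.le (hC' q)) ?_
    intro u v w z
    simp only [curvatureComb, metricSquareAt, curvatureAt, scalAt]
    field_simp
    ring
  · refine (h₂ q).mul_add (posDef_metricSquareAt g₂ q) (inv_pos.2 hε)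
      (sub_nonneg.2 (hm1 p (Set.mem_univ p))) ?_
    intro u v w z
    simp only [curvatureComb, metricSquareAt, curvatureAt, scalAt]
    field_simp
    ring

end Scaling

section Invariant

variable {E : Type*} [NormedAddCommGroup E] [NormedSpace ℝ E] [FiniteDimensional ℝ E]
  {H : Type*} [TopologicalSpace H] {I : ModelWithCorners ℝ E H}
  {M : Type*} [TopologicalSpace M] [ChartedSpace H M] [IsManifold I ∞ M]

/-- The dimensional bound `n (n - 1) / 2`. -/
def dimBound (E : Type*) [AddCommGroup E] [Module ℝ E] : ℝ :=
  (Module.finrank ℝ E : ℝ) * ((Module.finrank ℝ E : ℝ) - 1) / 2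

theorem exists_of_lt_riemManifold {c : ℝ} (hc : 0 ≤ c) (h : c < riemManifold I M) :
    ∃ (g : Metric I M) (t : ℝ), c < t ∧ t < dimBound E ∧ (∀ p, 0 < scalAt g p) ∧
      RiemTensorPos g t := by
  have hne : (Set.range fun g : Metric I M => riemMetric g).Nonempty := by
    by_contra hne
    rw [riemManifold, Set.not_nonempty_iff_eq_empty.1 hne, Real.sSup_empty] at h
    linarith
  obtain ⟨_, ⟨g, rfl⟩, hg⟩ := exists_lt_of_lt_csSup hne h
  simp only [riemMetric] at hg
  split_ifs at hg with hs
  · have hne' : {t : ℝ | 0 < t ∧ t < dimBound E ∧ RiemTensorPos g t}.Nonempty := by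
      by_contra hne'
      have h0 := Set.not_nonempty_iff_eq_empty.1 hne'
      unfold dimBound at h0
      rw [h0, Real.sSup_empty] at hg
      linarith
    obtain ⟨t, ht, hct⟩ := exists_lt_of_lt_csSup hne' hg
    exact ⟨g, t, hct, ht.2.1, hs, ht.2.2⟩
  · linarith

theorem le_riemManifold (g : Metric I M) {t : ℝ} (h0 : 0 < t) (ht : t < dimBound E)
    (hs : ∀ p, 0 < scalAt g p) (hp : RiemTensorPos g t) : t ≤ riemManifold I M := by
  refine le_trans ?_ (le_csSup (bddAbove_riemMetric I M) ⟨g, rfl⟩)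
  simp only [riemMetric, if_pos hs]
  exact le_csSup ⟨dimBound E, fun s hs => hs.2.1.le⟩ ⟨h0, ht, hp⟩

theorem riemManifold_nonneg : 0 ≤ riemManifold I M := by
  refine Real.sSup_nonneg ?_
  rintro _ ⟨g, rfl⟩
  exact riemMetric_nonneg g

theorem dimBound_nonneg (E : Type*) [AddCommGroup E] [Module ℝ E] : 0 ≤ dimBound E := by
  unfold dimBound
  rcases Nat.eq_zero_or_pos (Module.finrank ℝ E) with h | h
  · simp [h]
  · have : (1 : ℝ) ≤ Module.finrank ℝ E := by exact_mod_cast h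
    have := mul_nonneg (by linarith : (0 : ℝ) ≤ Module.finrank ℝ E) (sub_nonneg.2 this)
    linarith

theorem dimBound_prod (E₁ E₂ : Type*) [AddCommGroup E₁] [Module ℝ E₁] [AddCommGroup E₂]
    [Module ℝ E₂] [FiniteDimensional ℝ E₁] [FiniteDimensional ℝ E₂] :
    dimBound E₁ + dimBound E₂ ≤ dimBound (E₁ × E₂) := by
  have h : (0 : ℝ) ≤ (Module.finrank ℝ E₁ : ℝ) * (Module.finrank ℝ E₂ : ℝ) := by positivity
  simp only [dimBound, Module.finrank_prod, Nat.cast_add]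
  linarith

end Invariant

end RiemInv

end

theorem mainTheorem8
    {E₁ : Type*} [NormedAddCommGroup E₁] [NormedSpace ℝ E₁] [FiniteDimensional ℝ E₁]
    {H₁ : Type*} [TopologicalSpace H₁] (I₁ : ModelWithCorners ℝ E₁ H₁) [I₁.Boundaryless]
    {E₂ : Type*} [NormedAddCommGroup E₂] [NormedSpace ℝ E₂] [FiniteDimensional ℝ E₂]
    {H₂ : Type*} [TopologicalSpace H₂] (I₂ : ModelWithCorners ℝ E₂ H₂) [I₂.Boundaryless]
    (M₁ : Type*) [TopologicalSpace M₁] [ChartedSpace H₁ M₁] [IsManifold I₁ ∞ M₁]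
    [T2Space M₁] [CompactSpace M₁] [Nonempty M₁]
    (M₂ : Type*) [TopologicalSpace M₂] [ChartedSpace H₂ M₂] [IsManifold I₂ ∞ M₂]
    [T2Space M₂] [CompactSpace M₂] [Nonempty M₂] :
    max (RiemInv.riemManifold I₁ M₁) (RiemInv.riemManifold I₂ M₂) ≤
      RiemInv.riemManifold (I₁.prod I₂) (M₁ × M₂) := by
  open RiemInv in
  have h0 := riemManifold_nonneg (I := I₁.prod I₂) (M := M₁ × M₂)
  have hd := dimBound_prod E₁ E₂
  have hd₁ := dimBound_nonneg E₁
  have hd₂ := dimBound_nonneg E₂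
  refine max_le ?_ ?_ <;> by_contra! hlt
  · obtain ⟨g₁, t, hct, htd, hs, ht⟩ := exists_of_lt_riemManifold h0 hlt
    obtain ⟨g₂⟩ := nonempty_metric I₂ M₂
    obtain ⟨ε, hε, hS, h₁, h₂⟩ := exists_scaling g₁ g₂ hs ht
    have := le_riemManifold (prodRiemannian hε one_pos g₁ g₂) (h0.trans_lt hct) (by linarith)
      (fun p => by rw [scalAt_prodRiemannian]; simpa using hS p.1 p.2)
      (riemTensorPos_prodRiemannian hε one_pos g₁ g₂ (by simpa using hS) (by simpa using h₁)
        (by simpa using h₂))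
    linarith
  · obtain ⟨g₂, t, hct, htd, hs, ht⟩ := exists_of_lt_riemManifold h0 hlt
    obtain ⟨g₁⟩ := nonempty_metric I₁ M₁
    obtain ⟨ε, hε, hS, h₁, h₂⟩ := exists_scaling g₂ g₁ hs ht
    have := le_riemManifold (prodRiemannian one_pos hε g₁ g₂) (h0.trans_lt hct) (by linarith)
      (fun p => by rw [scalAt_prodRiemannian, add_comm]; simpa using hS p.2 p.1)
      (riemTensorPos_prodRiemannian one_pos hε g₁ g₂
        (fun p q => by rw [add_comm]; simpa using hS q p)
        (fun p q => by rw [add_comm]; simpa using h₂ q p)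
        (fun p q => by rw [add_comm]; simpa using h₁ q p))
    linarith
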